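/- **Setting.** Fix $d_1,d_2$, known measurable feature maps $\phi:\mathcal S\times\mathcal A\to\mathbb R^{d_1}$, $\psi_0:\mathcal X\to\mathbb R$, $\psi:\mathcal X\to\mathbb R^{d_2}$, and parameters $\theta_*\in\mathbb R^{d_1}$, $\gamma_*\in\mathbb R^{d_2}$. Write $r_\theta(s,a)=\theta^\top\phi(s,a)$, $\sigma_\gamma(x)=\psi_0(x)+\gamma^\top\psi(x)$, $\mu(v)=1/(1+e^{-v})$, $z=\phi(s,a^{(1)})-\phi(s,a^{(0)})$. An observation $(x,s,a^{(0)},a^{(1)},y)$, $y\in\{0,1\}$, has a law $Q$ with $\mathbb P(y=1\mid x,s,a^{(0)},a^{(1)})=\mu(\sigma_{\gamma_*}(x)\,\theta_*^\top z)$. For $n$ i.i.d. observations put $$L_n(\theta,\gamma)=-\frac1n\sum_{i=1}^n\{y_i\log\mu(\sigma_\gamma(x_i)\theta^\top z_i)+(1-y_i)\log[1-\mu(\sigma_\gamma(x_i)\theta^\top z_i)]\},$$ and, from initial points $\theta_0,\gamma_0$ and step sizes $\eta_1,\eta_2$, let for $t\ge1$ $$\theta_t=\theta_{t-1}-\eta_1\nabla_\theta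 L_n(\theta_{t-1},\gamma_{t-1}),\qquad \gamma_t=\gamma_{t-1}-\eta_2\nabla_\gamma L_n(\theta_t,\gamma_{t-1}).$$ With $v_i=\sigma_\gamma(x_i)\theta^\top z_i$ and $w_i=\mu(v_i)[1-\mu(v_i)]$ let $$\hat{\mathcal I}_{\theta\theta}=\frac1n\sum_i w_i\sigma_\gamma^2(x_i)z_iz_i^\top,\quad \hat{\mathcal I}_{\gamma\gamma}=\frac1n\sum_i w_i(\theta^\top z_i)^2\psi(x_i)\psi(x_i)^\top,\quad \hat{\mathcal I}_{\gamma\theta}=\hat{\mathcal I}_{\theta\gamma}^\top=\frac1n\sum_i w_iv_i\,\psi(x_i)z_i^\top,$$ $$S_\theta^2(\theta,\gamma)=[\hat{\mathcal I}_{\theta\theta}-\hat{\mathcal I}_{\theta\gamma}\hat{\mathcal I}_{\gamma\gamma}^{-1}\hat{\mathcal I}_{\theta\gamma}^\top]^{-1},\qquad S_\theta^{-2}=(S_\theta^2)^{-1},\qquad \|u\|_B=\sqrt{u^\top Bu},$$ and let $q_p$ be the $p$-quantile of the standard normal distribution. **Assumptions.** 1. $\|\phi(s,a)\|_2\le\phi_{\max}$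 for all $(s,a)$ and $\|\theta_*\|_\infty\le\theta_{\max}$, with $\phi_{\max},\theta_{\max}>0$. 2. $\psi_0\not\equiv0$, $\sup_x\|(\psi_0(x),\psi(x)^\top)\|_2\le\psi_{\max}$ and $\|(1,\gamma_*^\top)\|_\infty\le\gamma_{\max}$, with $\psi_{\max},\gamma_{\max}>0$. 3. The smallest eigenvalues of $\mathbb E[\sigma_{\gamma_*}^2(x)zz^\top]$ and $\mathbb E[(\theta_*^\top z)^2\psi(x)\psi(x)^\top]$ are $\lambda_\phi>0$ and $\lambda_\psi>0$. 4. With $v_*=\sigma_{\gamma_*}(x)\theta_*^\top z$, $$\bigl\|\mathbb E\{\mu(v_*)[1-\mu(v_*)]\,v_*\,\psi(x)z^\top\}\bigr\|_2<\frac{\min\{\lambda_\phi,\lambda_\psi\}}{6c_0},$$ where $c_0=(1+e^{C_{\max}})^2/e^{C_{\max}}$, $C_{\max}=(\sqrt2\gamma_{\max}+\tilde b)(\sqrt2\theta_{\max}+\tilde b)\sqrt{d_1d_2}\,\phi_{\max}\psi_{\max}$ and $\tilde b=\dfrac{\min\{\lambda_\phi/(\sqrt{d_2}\gamma_{\max}),\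 \lambda_\psi/(\sqrt{d_1}\theta_{\max})\}}{8\sqrt2\,\phi_{\max}^2\psi_{\max}^2}$. 5. $\tilde{\mathcal I}=\mathcal I_{\theta\theta}-\mathcal I_{\theta\gamma}\mathcal I_{\gamma\gamma}^{-1}\mathcal I_{\gamma\theta}$ is positive definite, where $\mathcal I_{\theta\theta},\mathcal I_{\theta\gamma},\mathcal I_{\gamma\theta},\mathcal I_{\gamma\gamma}$ are the blocks of $\mathbb E\nabla^2L_n(\theta_*,\gamma_*)$ (which does not depend on $n\ge 1$). **Claim.** There is $b_0>0$ such that for every $0\le b<b_0$ there is $\eta_0>0$ such that for all $\eta_1,\eta_2\in(0,\eta_0)$ there is $n_0$ such that for every $\delta\in(0,1)$ there are $\alpha\in(0,1)$ and $c>0$ with the following property. For all initial points with $\|\theta_0-\theta_*\|_2\le b/\sqrt2$ and $\|\gamma_0-\gamma_*\|_2\le b/\sqrt2$, all $n>n_0$ and all $T>c\log n$, with probability at least $1-\delta-\frac1n$ the matrices $\hat{\mathcal I}_{\gamma\gamma}$ and $\hat{\mathcal I}_{\theta\theta}-\hat{\mathcal I}_{\theta\gamma}\hat{\mathcal I}_{\gamma\gamma}^{-1}\hat{\mathcal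 I}_{\theta\gamma}^\top$ at $(\theta_T,\gamma_T)$ are positive definite (so that $S_\theta^2(\theta_T,\gamma_T)$ is well defined), and $$\|\theta_T-\theta_*\|_{S_\theta^{-2}(\theta_T,\gamma_T)}\le\frac{q_{1-\alpha/2}}{\sqrt n}.$$ -/

import Mathlib

open MeasureTheory ProbabilityTheory

noncomputable section

namespace RewardLearning

/-- Parameter space `ℝ^d` with the Euclidean norm. -/
abbrev Vec (d : ℕ) := EuclideanSpace ℝ (Fin d)

/-- One observation `((x, s, a⁽⁰⁾, a⁽¹⁾), y)`; `y = true` means that `a⁽¹⁾` is preferred. -/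
abbrev Obs (X S A : Type*) := (X × S × A × A) × Bool

/-- The known feature maps `φ : S × A → ℝ^{d₁}`, `ψ₀ : X → ℝ`, `ψ : X → ℝ^{d₂}`. -/
structure Features (X S A : Type*) (d₁ d₂ : ℕ) where
  phi : S → A → Vec d₁
  psi0 : X → ℝ
  psi : X → Vec d₂

/-- The preference label as a real number in `{0, 1}`. -/
def label {X S A : Type*} (o : Obs X S A) : ℝ := if o.2 then 1 else 0

/-- The standard normal quantile `q_p`. -/
def normalQuantile (p : ℝ) : ℝ := sInf {x : ℝ | p ≤ cdf (gaussianReal 0 1) x}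

/-- The spectral norm (operator norm for the Euclidean norms) of a matrix. -/
def specNorm {m n : ℕ} (B : Matrix (Fin m) (Fin n) ℝ) : ℝ :=
  ‖(Matrix.toEuclideanLin B).toContinuousLinearMap‖

/-- The weighted norm `‖v‖_B = √(vᵀ B v)`. -/
def weightedNorm {d : ℕ} (B : Matrix (Fin d) (Fin d) ℝ) (v : Vec d) : ℝ :=
  Real.sqrt (v.ofLp ⬝ᵥ B.mulVec v.ofLp)

/-- The outer product `u vᵀ`. -/
def outer {m n : ℕ} (u : Vec m) (v : Vec n) : Matrix (Fin m) (Fin n) ℝ :=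
  Matrix.vecMulVec u.ofLp v.ofLp

/-- Entrywise expectation of a random matrix. -/
def expMat {α : Type*} [MeasurableSpace α] {m n : ℕ} (Q : Measure α)
    (B : α → Matrix (Fin m) (Fin n) ℝ) : Matrix (Fin m) (Fin n) ℝ :=
  Matrix.of fun j k => ∫ o, B o j k ∂Q

section Hessian

variable {m n : ℕ}

/-- The block `∇²_{θθ} f`, with entries `∂_{θ_k} (∇_θ f)_j`. -/
def hessTT (f : Vec m → Vec n → ℝ) (θ : Vec m) (γ : Vec n) : Matrix (Fin m) (Fin m) ℝ :=
  Matrix.of fun j k =>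
    (fderiv ℝ (fun θ' => gradient (fun θ'' => f θ'' γ) θ') θ (EuclideanSpace.single k 1)) j

/-- The block `∇²_{θγ} f`, with entries `∂_{γ_k} (∇_θ f)_j`. -/
def hessTG (f : Vec m → Vec n → ℝ) (θ : Vec m) (γ : Vec n) : Matrix (Fin m) (Fin n) ℝ :=
  Matrix.of fun j k =>
    (fderiv ℝ (fun γ' => gradient (fun θ' => f θ' γ') θ) γ (EuclideanSpace.single k 1)) j

/-- The block `∇²_{γθ} f`, with entries `∂_{θ_k} (∇_γ f)_j`. -/
def hessGT (f : Vec m → Vec n → ℝ) (θ : Vec m) (γ : Vec n) : Matrix (Fin n) (Fin m) ℝ :=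
  Matrix.of fun j k =>
    (fderiv ℝ (fun θ' => gradient (fun γ' => f θ' γ') γ) θ (EuclideanSpace.single k 1)) j

/-- The block `∇²_{γγ} f`, with entries `∂_{γ_k} (∇_γ f)_j`. -/
def hessGG (f : Vec m → Vec n → ℝ) (θ : Vec m) (γ : Vec n) : Matrix (Fin n) (Fin n) ℝ :=
  Matrix.of fun j k =>
    (fderiv ℝ (fun γ' => gradient (fun γ'' => f θ γ'') γ') γ (EuclideanSpace.single k 1)) j

end Hessian

section Model

variable {X S A : Type*} {d₁ d₂ : ℕ} (F : Features X S A d₁ d₂)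

/-- The reward `r_θ(s, a) = θᵀ φ(s, a)`. -/
def reward (θ : Vec d₁) (s : S) (a : A) : ℝ := inner ℝ θ (F.phi s a)

/-- The rationality scale `σ_γ(x) = ψ₀(x) + γᵀ ψ(x)`. -/
def scale (γ : Vec d₂) (x : X) : ℝ := F.psi0 x + inner ℝ γ (F.psi x)

/-- The context `x` of an observation. -/
def ctx (o : Obs X S A) : X := o.1.1

/-- The feature difference `z = φ(s, a⁽¹⁾) - φ(s, a⁽⁰⁾)` of an observation. -/
def featDiff (o : Obs X S A) : Vec d₁ := F.phi o.1.2.1 o.1.2.2.2 - F.phi o.1.2.1 o.1.2.2.1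

/-- The logit `σ_γ(x) (r_θ(s, a⁽¹⁾) - r_θ(s, a⁽⁰⁾))` of the preference probability. -/
def logit (θ : Vec d₁) (γ : Vec d₂) (o : Obs X S A) : ℝ :=
  scale F γ o.1.1 * (reward F θ o.1.2.1 o.1.2.2.2 - reward F θ o.1.2.1 o.1.2.2.1)

/-- `μ(v) (1 - μ(v))` at the logit `v`, where `μ` is the logistic function `Real.sigmoid`. -/
def logitVar (θ : Vec d₁) (γ : Vec d₂) (o : Obs X S A) : ℝ :=
  Real.sigmoid (logit F θ γ o) * (1 - Real.sigmoid (logit F θ γ o))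

/-- The negative log-likelihood of a single observation. -/
def obsLoss (o : Obs X S A) (θ : Vec d₁) (γ : Vec d₂) : ℝ :=
  -(label o * Real.log (Real.sigmoid (logit F θ γ o))
    + (1 - label o) * Real.log (1 - Real.sigmoid (logit F θ γ o)))

/-- The negative log-likelihood `L_n(θ, γ)` of a data set of size `n`. -/
def empLoss {n : ℕ} (D : Fin n → Obs X S A) (θ : Vec d₁) (γ : Vec d₂) : ℝ :=
  (1 / (n : ℝ)) * ∑ i, obsLoss F (D i) θ γ

/-- Alternating gradient descent: the pair `(θ_t, γ_t)`, with `θ` updated first and the new `θ`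
used in the update of `γ`. -/
def agd {n : ℕ} (D : Fin n → Obs X S A) (η₁ η₂ : ℝ) (θ₀ : Vec d₁) (γ₀ : Vec d₂) :
    ℕ → Vec d₁ × Vec d₂
  | 0 => (θ₀, γ₀)
  | t + 1 =>
    let θ := (agd D η₁ η₂ θ₀ γ₀ t).1
    let γ := (agd D η₁ η₂ θ₀ γ₀ t).2
    let θ' := θ - η₁ • gradient (fun u => empLoss F D u γ) θ
    let γ' := γ - η₂ • gradient (fun u => empLoss F D θ' u) γ
    (θ', γ')

/-- `Î_{θθ}(θ, γ)`. -/
def empInfoTT {n : ℕ} (D : Fin n → Obs X S A) (θ : Vec d₁) (γ : Vec d₂) :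
    Matrix (Fin d₁) (Fin d₁) ℝ :=
  (1 / (n : ℝ)) • ∑ i, (logitVar F θ γ (D i) * scale F γ (ctx (D i)) ^ 2) •
    outer (featDiff F (D i)) (featDiff F (D i))

/-- `Î_{γγ}(θ, γ)`. -/
def empInfoGG {n : ℕ} (D : Fin n → Obs X S A) (θ : Vec d₁) (γ : Vec d₂) :
    Matrix (Fin d₂) (Fin d₂) ℝ :=
  (1 / (n : ℝ)) • ∑ i, (logitVar F θ γ (D i) * inner ℝ θ (featDiff F (D i)) ^ 2) •
    outer (F.psi (ctx (D i))) (F.psi (ctx (D i)))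

/-- `Î_{γθ}(θ, γ)`; the block `Î_{θγ}` is its transpose. -/
def empInfoGT {n : ℕ} (D : Fin n → Obs X S A) (θ : Vec d₁) (γ : Vec d₂) :
    Matrix (Fin d₂) (Fin d₁) ℝ :=
  (1 / (n : ℝ)) • ∑ i,
    (logitVar F θ γ (D i) * (scale F γ (ctx (D i)) * inner ℝ θ (featDiff F (D i)))) •
      outer (F.psi (ctx (D i))) (featDiff F (D i))

/-- `Î_{θθ} - Î_{θγ} Î_{γγ}⁻¹ Î_{θγ}ᵀ` at `(θ, γ)`. -/
def empSchur {n : ℕ} (D : Fin n → Obs X S A) (θ : Vec d₁) (γ : Vec d₂) :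
    Matrix (Fin d₁) (Fin d₁) ℝ :=
  let ITG := (empInfoGT F D θ γ).transpose
  empInfoTT F D θ γ - ITG * (empInfoGG F D θ γ)⁻¹ * ITG.transpose

/-- `S_θ²(θ, γ) = [Î_{θθ} - Î_{θγ} Î_{γγ}⁻¹ Î_{θγ}ᵀ]⁻¹`. -/
def Ssq {n : ℕ} (D : Fin n → Obs X S A) (θ : Vec d₁) (γ : Vec d₂) :
    Matrix (Fin d₁) (Fin d₁) ℝ := (empSchur F D θ γ)⁻¹

/-- Boundedness of the reward features and of the true reward parameter. -/
structure RewardBounds (θs : Vec d₁) (φmax θmax : ℝ) : Prop where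
  phi_pos : 0 < φmax
  theta_pos : 0 < θmax
  phi_le : ∀ s a, ‖F.phi s a‖ ≤ φmax
  theta_le : ∀ j, |θs j| ≤ θmax

/-- Boundedness of the rationality features and of the true rationality parameter. -/
structure ScaleBounds (γs : Vec d₂) (ψmax γmax : ℝ) : Prop where
  psi_pos : 0 < ψmax
  gamma_pos : 0 < γmax
  psi0_ne : ∃ x, F.psi0 x ≠ 0
  psi_le : ∀ x, Real.sqrt (F.psi0 x ^ 2 + ‖F.psi x‖ ^ 2) ≤ ψmax
  one_le : 1 ≤ γmax
  gamma_le : ∀ j, |γs j| ≤ γmax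

variable [MeasurableSpace X] [MeasurableSpace S] [MeasurableSpace A]

/-- Measurability of the feature maps. -/
structure Features.IsMeasurable : Prop where
  phi : Measurable (Function.uncurry F.phi)
  psi0 : Measurable F.psi0
  psi : Measurable F.psi

/-- The preference model:
`P(Y = 1 | x, s, a⁽⁰⁾, a⁽¹⁾) = μ(σ_γ(x) (r_θ(s, a⁽¹⁾) - r_θ(s, a⁽⁰⁾)))`. -/
def FollowsModel (Q : Measure (Obs X S A)) (θs : Vec d₁) (γs : Vec d₂) : Prop :=
  Q[label | MeasurableSpace.comap Prod.fst inferInstance]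
    =ᵐ[Q] fun o => Real.sigmoid (logit F θs γs o)

/-- `lphi` and `lpsi` are the smallest eigenvalues of `E[σ_{γ_*}²(x) z zᵀ]` and
`E[(θ_*ᵀ z)² ψ(x) ψ(x)ᵀ]`, and both are positive. -/
structure WellConditioned (Q : Measure (Obs X S A)) (θs : Vec d₁) (γs : Vec d₂)
    (lphi lpsi : ℝ) : Prop where
  lphi_pos : 0 < lphi
  lpsi_pos : 0 < lpsi
  lphi_least : IsLeast (spectrum ℝ (expMat Q fun o =>
    scale F γs (ctx o) ^ 2 • outer (featDiff F o) (featDiff F o))) lphi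
  lpsi_least : IsLeast (spectrum ℝ (expMat Q fun o =>
    inner ℝ θs (featDiff F o) ^ 2 • outer (F.psi (ctx o)) (F.psi (ctx o)))) lpsi

/-- `M = ‖E{μ(1-μ) σ_{γ_*}(x) (θ_*ᵀ z) ψ(x) zᵀ}‖₂`, with `μ` taken at the true logit. -/
def crossNorm (Q : Measure (Obs X S A)) (θs : Vec d₁) (γs : Vec d₂) : ℝ :=
  specNorm (expMat Q fun o =>
    (logitVar F θs γs o * scale F γs (ctx o) * inner ℝ θs (featDiff F o)) •
      outer (F.psi (ctx o)) (featDiff F o))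

/-- Population Fisher information blocks `E ∇² L_n(θ, γ)`. As the observations are identically
distributed, this is the expected Hessian of the loss of one observation. -/
def infoTT (Q : Measure (Obs X S A)) (θ : Vec d₁) (γ : Vec d₂) : Matrix (Fin d₁) (Fin d₁) ℝ :=
  expMat Q fun o => hessTT (obsLoss F o) θ γ

/-- See `infoTT`. -/
def infoTG (Q : Measure (Obs X S A)) (θ : Vec d₁) (γ : Vec d₂) : Matrix (Fin d₁) (Fin d₂) ℝ :=
  expMat Q fun o => hessTG (obsLoss F o) θ γ

/-- See `infoTT`. -/
def infoGT (Q : Measure (Obs X S A)) (θ : Vec d₁) (γ : Vec d₂) : Matrix (Fin d₂) (Fin d₁) ℝ :=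
  expMat Q fun o => hessGT (obsLoss F o) θ γ

/-- See `infoTT`. -/
def infoGG (Q : Measure (Obs X S A)) (θ : Vec d₁) (γ : Vec d₂) : Matrix (Fin d₂) (Fin d₂) ℝ :=
  expMat Q fun o => hessGG (obsLoss F o) θ γ

/-- `I_{θθ} - I_{θγ} I_{γγ}⁻¹ I_{γθ}` at `(θ, γ)`. -/
def effInfo (Q : Measure (Obs X S A)) (θ : Vec d₁) (γ : Vec d₂) : Matrix (Fin d₁) (Fin d₁) ℝ :=
  infoTT F Q θ γ - infoTG F Q θ γ * (infoGG F Q θ γ)⁻¹ * infoGT F Q θ γ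

end Model

/-- The radius `b̃`. -/
def radius (d₁ d₂ : ℕ) (φmax θmax ψmax γmax lphi lpsi : ℝ) : ℝ :=
  min (lphi / (Real.sqrt d₂ * γmax)) (lpsi / (Real.sqrt d₁ * θmax)) /
    (8 * Real.sqrt 2 * φmax ^ 2 * ψmax ^ 2)

/-- The constant `C_max`. -/
def cMax (d₁ d₂ : ℕ) (φmax θmax ψmax γmax lphi lpsi : ℝ) : ℝ :=
  (Real.sqrt 2 * γmax + radius d₁ d₂ φmax θmax ψmax γmax lphi lpsi) *
    (Real.sqrt 2 * θmax + radius d₁ d₂ φmax θmax ψmax γmax lphi lpsi) *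
    Real.sqrt ((d₁ : ℝ) * d₂) * φmax * ψmax

/-- The constant `c₀ = (1 + e^{C_max})² / e^{C_max}`. -/
def cZero (d₁ d₂ : ℕ) (φmax θmax ψmax γmax lphi lpsi : ℝ) : ℝ :=
  (1 + Real.exp (cMax d₁ d₂ φmax θmax ψmax γmax lphi lpsi)) ^ 2 /
    Real.exp (cMax d₁ d₂ φmax θmax ψmax γmax lphi lpsi)

end RewardLearning

end

namespace RewardLearning

/-! ### Second-order bounds for the logistic loss -/

/-! Since $\alpha$ is chosen after $\delta$ and $q_{1-\alpha/2}\to\infty$ as $\alpha\to0$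
(`exists_le_normalQuantile`), no limit law is needed. It suffices to bound $\sqrt n$ times the
weighted error by a constant that may depend on $\delta$ but not on $n$, $T$ or the starting point.

The logit is a product of two affine functions, so $L_n$ need not be jointly convex. Its expansion
at the truth contains the information form and a residual times a product of displacements, which
has no sign. Residuals have conditional mean zero given the covariates
(`FollowsModel.integral_residual_mul`). Hence the expected Hessian is a pure information matrix,
positive definite because $\mathcal I_{\gamma\gamma}$ and its Schur complement are
(`FollowsModel.posDef_popInfo`), and the indefinite term averages out. Hoeffding's inequality and a
union bound over finitely many entries carry both facts to the sample at a fixed precision, outside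
an event of probability at most $1/n$ for large $n$. The empirical loss is then strongly convex
between the truth and every point of a fixed small ball (`FeatureBound.locallyRegular_empLoss`).

This star-shaped convexity is enough for descent. It yields a Polyak–Łojasiewicz inequality, hence
geometric decay of the gap to the loss at the truth, and the gap in turn keeps the iterates in the
ball (`LocallyRegular.iterate`). The squared distance to the truth is at most a multiple of the gap
plus the squared score at the truth. The score is at most of order $K/\sqrt n$ outside an event of
probability $\delta$, and $c\log n$ rounds push the gap below order $1/n$. The weight matrix is at
most $\hat{\mathcal I}_{\theta\theta}$, which is bounded (`FeatureBound.weightedNorm_agd_le`). -/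

/-- A lower bound on the second derivative gives a quadratic lower bound. -/
theorem quadratic_le_of_le_deriv2 {f f' f'' : ℝ → ℝ} (h₁ : ∀ x, HasDerivAt f (f' x) x)
    (h₂ : ∀ x, HasDerivAt f' (f'' x) x) {a b κ : ℝ} (hκ : ∀ t ∈ Set.uIcc a b, κ ≤ f'' t) :
    f b + f' b * (a - b) + κ / 2 * (a - b) ^ 2 ≤ f a := by
  have hline : ∀ t : ℝ, HasDerivAt (fun t : ℝ => b + t * (a - b)) (a - b) t := fun t => by
    simpa using ((hasDerivAt_id t).mul_const (a - b)).const_add b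
  have hmem : ∀ t ∈ Set.Icc (0 : ℝ) 1, b + t * (a - b) ∈ Set.uIcc a b := by
    intro t ht
    rcases le_total a b with h | h
    · rw [Set.uIcc_of_le h]
      constructor <;> nlinarith [ht.1, ht.2]
    · rw [Set.uIcc_of_ge h]
      constructor <;> nlinarith [ht.1, ht.2]
  -- Along the segment from `b` to `a`, removing the quadratic with curvature `κ` leaves a
  -- derivative that is monotone. The corrected function is then monotone too, and comparing its
  -- endpoints gives the claim.
  have hd1 : ∀ t : ℝ, HasDerivAt (fun t => f' (b + t * (a - b)) * (a - b) - κ * (a - b) ^ 2 * t)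
      (f'' (b + t * (a - b)) * (a - b) * (a - b) - κ * (a - b) ^ 2) t := fun t => by
    have h := ((h₂ _).comp t (hline t)).mul_const (a - b)
    exact (h.sub ((hasDerivAt_id t).const_mul (κ * (a - b) ^ 2))).congr_deriv (by simp)
  have hmono1 : MonotoneOn (fun t => f' (b + t * (a - b)) * (a - b) - κ * (a - b) ^ 2 * t)
      (Set.Icc 0 1) := by
    refine monotoneOn_of_deriv_nonneg (convex_Icc 0 1)
      (fun t _ => (hd1 t).continuousAt.continuousWithinAt)
      (fun t _ => (hd1 t).differentiableAt.differentiableWithinAt) fun t ht => ?_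
    rw [interior_Icc] at ht
    rw [(hd1 t).deriv]
    nlinarith [hκ _ (hmem t ⟨ht.1.le, ht.2.le⟩), sq_nonneg (a - b)]
  have hd2 : ∀ t : ℝ, HasDerivAt
      (fun t => f (b + t * (a - b)) - f' b * (a - b) * t - κ / 2 * (a - b) ^ 2 * t ^ 2)
      (f' (b + t * (a - b)) * (a - b) - f' b * (a - b) - κ * (a - b) ^ 2 * t) t := fun t => by
    have h := (h₁ _).comp t (hline t)
    have h' := (h.sub ((hasDerivAt_id t).const_mul (f' b * (a - b)))).sub
      (((hasDerivAt_id t).pow 2).const_mul (κ / 2 * (a - b) ^ 2))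
    refine h'.congr_deriv ?_
    simp only [id, Nat.cast_ofNat]
    ring
  have hmono2 : MonotoneOn
      (fun t => f (b + t * (a - b)) - f' b * (a - b) * t - κ / 2 * (a - b) ^ 2 * t ^ 2)
      (Set.Icc 0 1) := by
    refine monotoneOn_of_deriv_nonneg (convex_Icc 0 1)
      (fun t _ => (hd2 t).continuousAt.continuousWithinAt)
      (fun t _ => (hd2 t).differentiableAt.differentiableWithinAt) fun t ht => ?_
    rw [interior_Icc] at ht
    rw [(hd2 t).deriv]
    have := hmono1 ⟨le_rfl, zero_le_one⟩ ⟨ht.1.le, ht.2.le⟩ ht.1.le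
    simp only [zero_mul, add_zero, mul_zero, sub_zero] at this
    linarith
  have := hmono2 (Set.left_mem_Icc.2 zero_le_one) (Set.right_mem_Icc.2 zero_le_one) zero_le_one
  simp only [zero_mul, add_zero, mul_zero, sub_zero, one_mul, mul_one, one_pow,
    add_sub_cancel] at this
  norm_num at this
  linarith

/-- The softplus function `v ↦ log (1 + e^v)`, written through the logistic function. -/
noncomputable def softplus (v : ℝ) : ℝ := -Real.log (1 - Real.sigmoid v)

/-- The derivative `μ (1 - μ)` of the logistic function. -/
noncomputable def sigmoidVar (v : ℝ) : ℝ := Real.sigmoid v * (1 - Real.sigmoid v)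

theorem hasDerivAt_sigmoid' (v : ℝ) : HasDerivAt Real.sigmoid (sigmoidVar v) v :=
  Real.hasDerivAt_sigmoid v

theorem hasDerivAt_softplus (v : ℝ) : HasDerivAt softplus (Real.sigmoid v) v := by
  have h1 : 1 - Real.sigmoid v ≠ 0 := by linarith [Real.sigmoid_lt_one v]
  have := (((hasDerivAt_sigmoid' v).const_sub 1).log h1).neg
  refine this.congr_deriv ?_
  rw [sigmoidVar]
  field_simp

theorem neg_log_sigmoid (v : ℝ) : -Real.log (Real.sigmoid v) = softplus v - v := by
  have h := Real.sigmoid_mul_rexp_neg v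
  rw [Real.sigmoid_neg] at h
  rw [softplus, ← h, Real.log_mul (Real.sigmoid_pos v).ne' (Real.exp_pos _).ne', Real.log_exp]
  ring

theorem sigmoidVar_pos (v : ℝ) : 0 < sigmoidVar v :=
  mul_pos (Real.sigmoid_pos v) (by linarith [Real.sigmoid_lt_one v])

theorem sigmoidVar_le_one (v : ℝ) : sigmoidVar v ≤ 1 := by
  unfold sigmoidVar
  nlinarith [Real.sigmoid_pos v, Real.sigmoid_lt_one v]

theorem abs_sigmoid_sub_le (a b : ℝ) : |Real.sigmoid a - Real.sigmoid b| ≤ |a - b| := by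
  have := convex_univ.norm_image_sub_le_of_norm_hasDerivWithin_le (C := 1) (x := b) (y := a)
    (fun v _ => (hasDerivAt_sigmoid' v).hasDerivWithinAt)
    (fun v _ => by
      rw [Real.norm_eq_abs, abs_of_pos (sigmoidVar_pos v)]; exact sigmoidVar_le_one v)
    (Set.mem_univ b) (Set.mem_univ a)
  simpa [Real.norm_eq_abs] using this

/-- $\mu(1-\mu)$ is quadratic in $\mu$, so the difference factors through
$1-\mu(a)-\mu(b)\in[-1,1]$. This is the control of the third derivative of softplus. -/
theorem abs_sigmoidVar_sub_le (a b : ℝ) : |sigmoidVar a - sigmoidVar b| ≤ |a - b| := by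
  refine le_trans ?_ (abs_sigmoid_sub_le a b)
  have : sigmoidVar a - sigmoidVar b
      = (Real.sigmoid a - Real.sigmoid b) * (1 - Real.sigmoid a - Real.sigmoid b) := by
    unfold sigmoidVar; ring
  rw [this, abs_mul]
  refine mul_le_of_le_one_right (abs_nonneg _) ?_
  rw [abs_le]
  constructor <;> linarith [Real.sigmoid_pos a, Real.sigmoid_pos b, Real.sigmoid_lt_one a,
    Real.sigmoid_lt_one b]

theorem softplus_le (a b : ℝ) :
    softplus a ≤ softplus b + Real.sigmoid b * (a - b) + 1 / 2 * (a - b) ^ 2 := by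
  have := quadratic_le_of_le_deriv2 (f := fun v => -softplus v) (κ := -1) (a := a) (b := b)
    (fun v => (hasDerivAt_softplus v).neg) (fun v => (hasDerivAt_sigmoid' v).neg)
    (fun t _ => neg_le_neg (sigmoidVar_le_one t))
  linarith

/-- The Bregman divergence of the softplus function is bounded below by the quadratic form at
any point `c` between its arguments, up to a third-order term. -/
theorem le_softplus (a b c : ℝ) (hc : c ∈ Set.uIcc a b) :
    softplus b + Real.sigmoid b * (a - b) + (sigmoidVar c - |a - b|) / 2 * (a - b) ^ 2
      ≤ softplus a := by
  refine quadratic_le_of_le_deriv2 hasDerivAt_softplus hasDerivAt_sigmoid' fun t ht => ?_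
  have h1 := (abs_le.1 (abs_sigmoidVar_sub_le c t)).2
  have h2 := Set.abs_sub_le_of_uIcc_subset_uIcc (Set.uIcc_subset_uIcc hc ht)
  rw [abs_sub_comm t c, abs_sub_comm b a] at h2
  linarith

/-! ### Gradients and Hessian blocks of the loss -/

section Gradients

variable {X S A : Type*} {d₁ d₂ : ℕ} (F : Features X S A d₁ d₂)

theorem logit_eq (θ : Vec d₁) (γ : Vec d₂) (o : Obs X S A) :
    logit F θ γ o = scale F γ (ctx o) * inner ℝ θ (featDiff F o) := by
  simp only [logit, reward, featDiff, ctx, inner_sub_right]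

theorem logitVar_eq (θ : Vec d₁) (γ : Vec d₂) (o : Obs X S A) :
    logitVar F θ γ o = sigmoidVar (logit F θ γ o) := rfl

/-- In this form the label enters only linearly in the logit, so all curvature in the logit comes
from softplus. -/
theorem obsLoss_eq (o : Obs X S A) (θ : Vec d₁) (γ : Vec d₂) :
    obsLoss F o θ γ = softplus (logit F θ γ o) - label o * logit F θ γ o := by
  have h := neg_log_sigmoid (logit F θ γ o)
  have h' : -Real.log (1 - Real.sigmoid (logit F θ γ o)) = softplus (logit F θ γ o) := rfl
  rw [obsLoss]
  linear_combination label o * h + (1 - label o) * h'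

theorem label_nonneg (o : Obs X S A) : 0 ≤ label o := by unfold label; split_ifs <;> norm_num

theorem label_le_one (o : Obs X S A) : label o ≤ 1 := by unfold label; split_ifs <;> norm_num

/-- The residual `μ(v) - y`. -/
noncomputable def residual (θ : Vec d₁) (γ : Vec d₂) (o : Obs X S A) : ℝ :=
  Real.sigmoid (logit F θ γ o) - label o

theorem abs_residual_le_one (θ : Vec d₁) (γ : Vec d₂) (o : Obs X S A) :
    |residual F θ γ o| ≤ 1 := by
  unfold residual
  rw [abs_le]
  constructor <;> linarith [label_nonneg o, label_le_one o, Real.sigmoid_pos (logit F θ γ o),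
    Real.sigmoid_lt_one (logit F θ γ o)]

/-- The `θ`-gradient of the loss of one observation. -/
noncomputable def scoreT (o : Obs X S A) (θ : Vec d₁) (γ : Vec d₂) : Vec d₁ :=
  (residual F θ γ o * scale F γ (ctx o)) • featDiff F o

/-- The `γ`-gradient of the loss of one observation. -/
noncomputable def scoreG (o : Obs X S A) (θ : Vec d₁) (γ : Vec d₂) : Vec d₂ :=
  (residual F θ γ o * inner ℝ θ (featDiff F o)) • F.psi (ctx o)

theorem hasFDerivAt_inner_right {d : ℕ} (u v : Vec d) :
    HasFDerivAt (fun w : Vec d => inner ℝ w v) (innerSL ℝ v) u := by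
  have := (innerSL ℝ v).hasFDerivAt (x := u)
  refine this.congr_of_eventuallyEq (Filter.Eventually.of_forall fun w => ?_)
  simp [real_inner_comm]

theorem hasFDerivAt_logit_left (o : Obs X S A) (θ : Vec d₁) (γ : Vec d₂) :
    HasFDerivAt (fun u => logit F u γ o) (scale F γ (ctx o) • innerSL ℝ (featDiff F o)) θ := by
  simp only [logit_eq]
  exact (hasFDerivAt_inner_right θ (featDiff F o)).const_mul _

theorem hasFDerivAt_scale (x : X) (γ : Vec d₂) :
    HasFDerivAt (fun u => scale F u x) (innerSL ℝ (F.psi x)) γ :=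
  (hasFDerivAt_inner_right γ (F.psi x)).const_add _

theorem hasFDerivAt_logit_right (o : Obs X S A) (θ : Vec d₁) (γ : Vec d₂) :
    HasFDerivAt (fun u => logit F θ u o)
      (inner ℝ θ (featDiff F o) • innerSL ℝ (F.psi (ctx o))) γ := by
  simp only [logit_eq]
  exact (hasFDerivAt_scale F (ctx o) γ).mul_const _

theorem hasFDerivAt_obsLoss {E : Type*} [NormedAddCommGroup E] [NormedSpace ℝ E] {y : ℝ}
    {v : E → ℝ} {v' : E →L[ℝ] ℝ} {u : E} (hv : HasFDerivAt v v' u) :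
    HasFDerivAt (fun u => softplus (v u) - y * v u) ((Real.sigmoid (v u) - y) • v') u := by
  have := ((hasDerivAt_softplus (v u)).comp_hasFDerivAt u hv).sub (hv.const_mul y)
  exact this.congr_fderiv (by ext w; simp; ring)

theorem hasGradientAt_obsLoss_left (o : Obs X S A) (θ : Vec d₁) (γ : Vec d₂) :
    HasGradientAt (fun u => obsLoss F o u γ) (scoreT F o θ γ) θ := by
  simp only [obsLoss_eq]
  rw [hasGradientAt_iff_hasFDerivAt]
  refine (hasFDerivAt_obsLoss (hasFDerivAt_logit_left F o θ γ)).congr_fderiv ?_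
  ext w
  simp [scoreT, residual, mul_assoc]

theorem hasGradientAt_obsLoss_right (o : Obs X S A) (θ : Vec d₁) (γ : Vec d₂) :
    HasGradientAt (fun u => obsLoss F o θ u) (scoreG F o θ γ) γ := by
  simp only [obsLoss_eq]
  rw [hasGradientAt_iff_hasFDerivAt]
  refine (hasFDerivAt_obsLoss (hasFDerivAt_logit_right F o θ γ)).congr_fderiv ?_
  ext w
  simp [scoreG, residual, mul_assoc]

/-- The `θ`-gradient of the empirical loss. -/
noncomputable def empScoreT {n : ℕ} (D : Fin n → Obs X S A) (θ : Vec d₁) (γ : Vec d₂) : Vec d₁ :=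
  (1 / (n : ℝ)) • ∑ i, scoreT F (D i) θ γ

/-- The `γ`-gradient of the empirical loss. -/
noncomputable def empScoreG {n : ℕ} (D : Fin n → Obs X S A) (θ : Vec d₁) (γ : Vec d₂) : Vec d₂ :=
  (1 / (n : ℝ)) • ∑ i, scoreG F (D i) θ γ

theorem gradient_empLoss_left {n : ℕ} (D : Fin n → Obs X S A) (θ : Vec d₁) (γ : Vec d₂) :
    gradient (fun u => empLoss F D u γ) θ = empScoreT F D θ γ := by
  refine HasGradientAt.gradient ?_
  rw [hasGradientAt_iff_hasFDerivAt]
  have := (HasFDerivAt.fun_sum (u := Finset.univ) fun i _ =>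
    (hasGradientAt_obsLoss_left F (D i) θ γ).hasFDerivAt).const_mul (1 / (n : ℝ))
  simpa [empLoss, empScoreT] using this

theorem gradient_empLoss_right {n : ℕ} (D : Fin n → Obs X S A) (θ : Vec d₁) (γ : Vec d₂) :
    gradient (fun u => empLoss F D θ u) γ = empScoreG F D θ γ := by
  refine HasGradientAt.gradient ?_
  rw [hasGradientAt_iff_hasFDerivAt]
  have := (HasFDerivAt.fun_sum (u := Finset.univ) fun i _ =>
    (hasGradientAt_obsLoss_right F (D i) θ γ).hasFDerivAt).const_mul (1 / (n : ℝ))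
  simpa [empLoss, empScoreG] using this

theorem hasFDerivAt_residual_left (o : Obs X S A) (θ : Vec d₁) (γ : Vec d₂) :
    HasFDerivAt (fun u => residual F u γ o)
      (logitVar F θ γ o • scale F γ (ctx o) • innerSL ℝ (featDiff F o)) θ :=
  ((hasDerivAt_sigmoid' _).comp_hasFDerivAt θ (hasFDerivAt_logit_left F o θ γ)).sub_const _

theorem hasFDerivAt_residual_right (o : Obs X S A) (θ : Vec d₁) (γ : Vec d₂) :
    HasFDerivAt (fun u => residual F θ u o)
      (logitVar F θ γ o • inner ℝ θ (featDiff F o) • innerSL ℝ (F.psi (ctx o))) γ :=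
  ((hasDerivAt_sigmoid' _).comp_hasFDerivAt γ (hasFDerivAt_logit_right F o θ γ)).sub_const _

theorem hessTT_obsLoss (o : Obs X S A) (θ : Vec d₁) (γ : Vec d₂) (j k : Fin d₁) :
    hessTT (obsLoss F o) θ γ j k =
      logitVar F θ γ o * (scale F γ (ctx o) * featDiff F o j)
        * (scale F γ (ctx o) * featDiff F o k) := by
  have h : (fun θ' => gradient (fun θ'' => obsLoss F o θ'' γ) θ') = fun u => scoreT F o u γ :=
    funext fun u => (hasGradientAt_obsLoss_left F o u γ).gradient
  have hd := ((hasFDerivAt_residual_left F o θ γ).mul_const (scale F γ (ctx o))).smul_const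
    (featDiff F o)
  rw [hessTT, Matrix.of_apply, h]
  unfold scoreT
  rw [hd.fderiv]
  simp [EuclideanSpace.inner_single_right]
  ring

/-- The logit is bilinear rather than affine, so the mixed block has a second term carrying the
residual. At the truth its expectation vanishes, see `FollowsModel.integral_residual_mul_cross`. -/
theorem hessTG_obsLoss (o : Obs X S A) (θ : Vec d₁) (γ : Vec d₂) (j : Fin d₁) (k : Fin d₂) :
    hessTG (obsLoss F o) θ γ j k =
      logitVar F θ γ o * (scale F γ (ctx o) * featDiff F o j)
        * (inner ℝ θ (featDiff F o) * F.psi (ctx o) k)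
      + residual F θ γ o * (featDiff F o j * F.psi (ctx o) k) := by
  have h : (fun γ' => gradient (fun θ' => obsLoss F o θ' γ') θ) = fun u => scoreT F o θ u :=
    funext fun u => (hasGradientAt_obsLoss_left F o θ u).gradient
  have hd := ((hasFDerivAt_residual_right F o θ γ).fun_mul (hasFDerivAt_scale F (ctx o) γ)).smul_const
    (featDiff F o)
  rw [hessTG, Matrix.of_apply, h]
  unfold scoreT
  rw [HasFDerivAt.fderiv hd]
  simp [EuclideanSpace.inner_single_right]
  ring

theorem hessGT_obsLoss (o : Obs X S A) (θ : Vec d₁) (γ : Vec d₂) (j : Fin d₂) (k : Fin d₁) :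
    hessGT (obsLoss F o) θ γ j k =
      logitVar F θ γ o * (scale F γ (ctx o) * featDiff F o k)
        * (inner ℝ θ (featDiff F o) * F.psi (ctx o) j)
      + residual F θ γ o * (featDiff F o k * F.psi (ctx o) j) := by
  have h : (fun θ' => gradient (fun γ' => obsLoss F o θ' γ') γ) = fun u => scoreG F o u γ :=
    funext fun u => (hasGradientAt_obsLoss_right F o u γ).gradient
  have hd := ((hasFDerivAt_residual_left F o θ γ).fun_mul
    (hasFDerivAt_inner_right θ (featDiff F o))).smul_const (F.psi (ctx o))
  rw [hessGT, Matrix.of_apply, h]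
  unfold scoreG
  rw [HasFDerivAt.fderiv hd]
  simp [EuclideanSpace.inner_single_right]
  ring

theorem hessGG_obsLoss (o : Obs X S A) (θ : Vec d₁) (γ : Vec d₂) (j k : Fin d₂) :
    hessGG (obsLoss F o) θ γ j k =
      logitVar F θ γ o * (inner ℝ θ (featDiff F o) * F.psi (ctx o) j)
        * (inner ℝ θ (featDiff F o) * F.psi (ctx o) k) := by
  have h : (fun γ' => gradient (fun γ'' => obsLoss F o θ γ'') γ') = fun u => scoreG F o θ u :=
    funext fun u => (hasGradientAt_obsLoss_right F o θ u).gradient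
  have hd := ((hasFDerivAt_residual_right F o θ γ).mul_const
    (inner ℝ θ (featDiff F o))).smul_const (F.psi (ctx o))
  rw [hessGG, Matrix.of_apply, h]
  unfold scoreG
  rw [hd.fderiv]
  simp [EuclideanSpace.inner_single_right]
  ring

end Gradients

/-! ### Local convergence of alternating gradient descent -/

section Descent

variable {E G : Type*} [NormedAddCommGroup E] [InnerProductSpace ℝ E]
  [NormedAddCommGroup G] [InnerProductSpace ℝ G]

/-- Strong convexity towards the point `(θs, γs)` on a product of balls of radius `R`, together with
blockwise smoothness and bounded gradients, for a function `f` with block gradients `gE`, `gG`. -/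
structure LocallyRegular (f : E → G → ℝ) (gE : E → G → E) (gG : E → G → G) (θs : E) (γs : G)
    (R m L M : ℝ) : Prop where
  tangent_center : ∀ θ γ, ‖θ - θs‖ ≤ R → ‖γ - γs‖ ≤ R →
    f θs γs + inner ℝ (gE θs γs) (θ - θs) + inner ℝ (gG θs γs) (γ - γs)
      + m / 2 * (‖θ - θs‖ ^ 2 + ‖γ - γs‖ ^ 2) ≤ f θ γ
  tangent_point : ∀ θ γ, ‖θ - θs‖ ≤ R → ‖γ - γs‖ ≤ R →
    f θ γ + m / 2 * (‖θ - θs‖ ^ 2 + ‖γ - γs‖ ^ 2)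
      ≤ f θs γs + inner ℝ (gE θ γ) (θ - θs) + inner ℝ (gG θ γ) (γ - γs)
  smooth_left : ∀ θ θ' γ, ‖θ - θs‖ ≤ R → ‖γ - γs‖ ≤ R →
    f θ' γ ≤ f θ γ + inner ℝ (gE θ γ) (θ' - θ) + L / 2 * ‖θ' - θ‖ ^ 2
  smooth_right : ∀ θ γ γ', ‖θ - θs‖ ≤ R → ‖γ - γs‖ ≤ R →
    f θ γ' ≤ f θ γ + inner ℝ (gG θ γ) (γ' - γ) + L / 2 * ‖γ' - γ‖ ^ 2
  lipschitz_right : ∀ θ θ' γ, ‖θ - θs‖ ≤ R → ‖θ' - θs‖ ≤ R → ‖γ - γs‖ ≤ R →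
    ‖gG θ γ - gG θ' γ‖ ≤ L * ‖θ - θ'‖
  bound_left : ∀ θ γ, ‖θ - θs‖ ≤ R → ‖γ - γs‖ ≤ R → ‖gE θ γ‖ ≤ M
  bound_right : ∀ θ γ, ‖θ - θs‖ ≤ R → ‖γ - γs‖ ≤ R → ‖gG θ γ‖ ≤ M

theorem norm_sub_smul_sub_le {x c g : E} {η r M : ℝ} (hη : 0 ≤ η) (hx : ‖x - c‖ ≤ r)
    (hg : ‖g‖ ≤ M) : ‖x - η • g - c‖ ≤ r + η * M := by
  have : x - η • g - c = (x - c) - η • g := by abel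
  rw [this]
  refine (norm_sub_le _ _).trans (add_le_add hx ?_)
  rw [norm_smul, Real.norm_of_nonneg hη]
  gcongr

/-- The descent lemma: for $\eta L\le1$ the quadratic term consumes at most half of the linear
decrease. -/
theorem gradient_step_le {x g : E} {η L f₀ f₁ : ℝ} (hη : 0 < η) (hL : η * L ≤ 1)
    (h : f₁ ≤ f₀ + inner ℝ g (x - η • g - x) + L / 2 * ‖x - η • g - x‖ ^ 2) :
    f₁ ≤ f₀ - η / 2 * ‖g‖ ^ 2 := by
  have e : x - η • g - x = -(η • g) := by abel
  rw [e, norm_neg, norm_smul, inner_neg_right, inner_smul_right, real_inner_self_eq_norm_sq,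
    Real.norm_of_nonneg hη.le] at h
  nlinarith [mul_le_mul_of_nonneg_right hL (mul_nonneg hη.le (sq_nonneg ‖g‖))]

variable {f : E → G → ℝ} {gE : E → G → E} {gG : E → G → G} {θs : E} {γs : G} {R m L M : ℝ}

/-- A Polyak–Łojasiewicz inequality relative to the centre. -/
theorem LocallyRegular.gap_le (H : LocallyRegular f gE gG θs γs R m L M) (hm : 0 < m)
    {θ : E} {γ : G} (hθ : ‖θ - θs‖ ≤ R) (hγ : ‖γ - γs‖ ≤ R) :
    2 * m * (f θ γ - f θs γs) ≤ ‖gE θ γ‖ ^ 2 + ‖gG θ γ‖ ^ 2 := by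
  have h := H.tangent_point θ γ hθ hγ
  have h1 := real_inner_le_norm (gE θ γ) (θ - θs)
  have h2 := real_inner_le_norm (gG θ γ) (γ - γs)
  have h3 : f θ γ - f θs γs ≤ ‖gE θ γ‖ * ‖θ - θs‖ + ‖gG θ γ‖ * ‖γ - γs‖
      - m / 2 * (‖θ - θs‖ ^ 2 + ‖γ - γs‖ ^ 2) := by linarith
  have h4 := mul_le_mul_of_nonneg_left h3 (by positivity : 0 ≤ 2 * m)
  -- The squares encode $gx-\frac m2x^2\le\frac{g^2}{2m}$ in each block.
  nlinarith [sq_nonneg (‖gE θ γ‖ - m * ‖θ - θs‖), sq_nonneg (‖gG θ γ‖ - m * ‖γ - γs‖)]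

/-- One round of alternating gradient descent started in the half-radius ball. -/
theorem LocallyRegular.step (H : LocallyRegular f gE gG θs γs R m L M) (hm : 0 < m)
    (hR : 0 ≤ R) {η₁ η₂ : ℝ} (h₁ : 0 < η₁) (h₂ : 0 < η₂)
    (h₁L : η₁ * L ≤ 1) (h₂L : η₂ * L ≤ 1)
    (h₁M : η₁ * M ≤ R / 2) (h₂M : η₂ * M ≤ R / 2) {θ θ' : E} {γ γ' : G}
    (hθ : ‖θ - θs‖ ≤ R / 2) (hγ : ‖γ - γs‖ ≤ R / 2)
    (hθ' : θ' = θ - η₁ • gE θ γ) (hγ' : γ' = γ - η₂ • gG θ' γ) :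
    ‖θ' - θs‖ ≤ R ∧ ‖γ' - γs‖ ≤ R ∧
      f θ' γ' - f θs γs ≤ (1 - min η₁ η₂ * m / 3) * (f θ γ - f θs γs) := by
  have hθR : ‖θ - θs‖ ≤ R := by linarith
  have hγR : ‖γ - γs‖ ≤ R := by linarith
  have hbE := H.bound_left θ γ hθR hγR
  -- A step moves by at most $\eta M\le R/2$, so the half-radius start keeps the new point where the
  -- regularity inequalities apply.
  have hθ'R : ‖θ' - θs‖ ≤ R := by
    rw [hθ']
    exact (norm_sub_smul_sub_le h₁.le hθ hbE).trans (by linarith)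
  have hbG := H.bound_right θ' γ hθ'R hγR
  have hγ'R : ‖γ' - γs‖ ≤ R := by
    rw [hγ']
    exact (norm_sub_smul_sub_le h₂.le hγ hbG).trans (by linarith)
  refine ⟨hθ'R, hγ'R, ?_⟩
  have s1 : f θ' γ ≤ f θ γ - η₁ / 2 * ‖gE θ γ‖ ^ 2 := by
    have := H.smooth_left θ θ' γ hθR hγR
    rw [hθ'] at this ⊢
    exact gradient_step_le h₁ h₁L this
  have s2 : f θ' γ' ≤ f θ' γ - η₂ / 2 * ‖gG θ' γ‖ ^ 2 := by
    have := H.smooth_right θ' γ γ' hθ'R hγR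
    rw [hγ'] at this ⊢
    exact gradient_step_le h₂ h₂L this
  -- The second half-step decreases the loss by the gradient at $(\theta',\gamma)$, while `gap_le`
  -- needs the one at $(\theta,\gamma)$. The change is at most $L\eta_1\|g_E\|\le\|g_E\|$. Squaring
  -- costs a factor 3 in the sum of squared gradients, which is the 3 in the rate.
  have s3 : ‖gG θ γ‖ ≤ ‖gG θ' γ‖ + ‖gE θ γ‖ := by
    have h := H.lipschitz_right θ θ' γ hθR hθ'R hγR
    have e : ‖θ - θ'‖ = η₁ * ‖gE θ γ‖ := by
      rw [hθ', sub_sub_cancel, norm_smul, Real.norm_of_nonneg h₁.le]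
    rw [e] at h
    have h' := norm_sub_norm_le (gG θ γ) (gG θ' γ)
    nlinarith [mul_le_mul_of_nonneg_right h₁L (norm_nonneg (gE θ γ))]
  have pl := H.gap_le hm hθR hγR
  have s4 : ‖gG θ γ‖ ^ 2 ≤ 2 * ‖gG θ' γ‖ ^ 2 + 2 * ‖gE θ γ‖ ^ 2 := by
    have := pow_le_pow_left₀ (norm_nonneg _) s3 2
    nlinarith [sq_nonneg (‖gG θ' γ‖ - ‖gE θ γ‖)]
  set η := min η₁ η₂ with hη
  have hη0 : 0 < η := lt_min h₁ h₂
  have a1 := mul_le_mul_of_nonneg_right (min_le_left η₁ η₂) (sq_nonneg ‖gE θ γ‖)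
  have a2 := mul_le_mul_of_nonneg_right (min_le_right η₁ η₂) (sq_nonneg ‖gG θ' γ‖)
  rw [← hη] at a1 a2
  have a3 : η * (2 * m * (f θ γ - f θs γs)) ≤ η * (3 * (‖gE θ γ‖ ^ 2 + ‖gG θ' γ‖ ^ 2)) :=
    mul_le_mul_of_nonneg_left (by nlinarith [sq_nonneg ‖gG θ' γ‖]) hη0.le
  nlinarith

/-- The distance to the centre is controlled by the gap and the gradient at the centre. -/
theorem LocallyRegular.sq_dist_le (H : LocallyRegular f gE gG θs γs R m L M) (hm : 0 < m)
    {ε : ℝ} (hE : ‖gE θs γs‖ ≤ ε) (hG : ‖gG θs γs‖ ≤ ε)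
    {θ : E} {γ : G} (hθ : ‖θ - θs‖ ≤ R) (hγ : ‖γ - γs‖ ≤ R) :
    m / 4 * (‖θ - θs‖ ^ 2 + ‖γ - γs‖ ^ 2) ≤ f θ γ - f θs γs + 2 * ε ^ 2 / m := by
  have h := H.tangent_center θ γ hθ hγ
  have h1 := neg_le_of_abs_le ((abs_real_inner_le_norm (gE θs γs) (θ - θs)).trans
    (mul_le_mul_of_nonneg_right hE (norm_nonneg _)))
  have h2 := neg_le_of_abs_le ((abs_real_inner_le_norm (gG θs γs) (γ - γs)).trans
    (mul_le_mul_of_nonneg_right hG (norm_nonneg _)))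
  -- Young's inequality: half of the strong convexity is spent on the nonzero gradient at the
  -- centre.
  have key : ∀ x : ℝ, ε * x ≤ m / 4 * x ^ 2 + ε ^ 2 / m := fun x => by
    have : m / 4 * x ^ 2 + ε ^ 2 / m - ε * x = (m * x / 2 - ε) ^ 2 / m := by
      field_simp
      ring
    have : 0 ≤ (m * x / 2 - ε) ^ 2 / m := by positivity
    linarith
  have k1 := key ‖θ - θs‖
  have k2 := key ‖γ - γs‖
  have : 2 * ε ^ 2 / m = ε ^ 2 / m + ε ^ 2 / m := by ring
  linarith

/-- Alternating gradient descent stays near the centre and its gap decays geometrically. -/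
theorem LocallyRegular.iterate (H : LocallyRegular f gE gG θs γs R m L M) (hm : 0 < m)
    (hR : 0 ≤ R) (hM : 0 ≤ M) {η₁ η₂ : ℝ} (h₁ : 0 < η₁) (h₂ : 0 < η₂)
    (h₁L : η₁ * L ≤ 1) (h₂L : η₂ * L ≤ 1) (h₁M : η₁ * M ≤ R / 2) (h₂M : η₂ * M ≤ R / 2)
    (hm₁ : η₁ * m ≤ 1) {ε b : ℝ} (hE : ‖gE θs γs‖ ≤ ε) (hG : ‖gG θs γs‖ ≤ ε)
    (hbR : b ≤ R / 2) (hsmall : 2 * M * b + 2 * ε ^ 2 / m ≤ m / 4 * (R / 2) ^ 2)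
    {u : ℕ → E × G} (hu₁ : ∀ t, (u (t + 1)).1 = (u t).1 - η₁ • gE (u t).1 (u t).2)
    (hu₂ : ∀ t, (u (t + 1)).2 = (u t).2 - η₂ • gG (u (t + 1)).1 (u t).2)
    (h0₁ : ‖(u 0).1 - θs‖ ≤ b) (h0₂ : ‖(u 0).2 - γs‖ ≤ b) (t : ℕ) :
    ‖(u t).1 - θs‖ ≤ R / 2 ∧ ‖(u t).2 - γs‖ ≤ R / 2 ∧
      f (u t).1 (u t).2 - f θs γs ≤ (1 - min η₁ η₂ * m / 3) ^ t * (2 * M * b) := by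
  have hb : 0 ≤ b := (norm_nonneg _).trans h0₁
  have hρ0 : 0 ≤ 1 - min η₁ η₂ * m / 3 := by
    have := mul_le_mul_of_nonneg_right (min_le_left η₁ η₂) hm.le
    linarith
  have hρ1 : 1 - min η₁ η₂ * m / 3 ≤ 1 := by
    have := mul_nonneg (lt_min h₁ h₂).le hm.le
    linarith
  induction t with
  | zero =>
    refine ⟨h0₁.trans hbR, h0₂.trans hbR, ?_⟩
    have hθ : ‖(u 0).1 - θs‖ ≤ R := by linarith
    have hγ : ‖(u 0).2 - γs‖ ≤ R := by linarith
    -- The initial gap is at most gradient times distance in each block, hence `2 * M * b`.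
    have h := H.tangent_point _ _ hθ hγ
    have h1 := (real_inner_le_norm (gE (u 0).1 (u 0).2) ((u 0).1 - θs)).trans
      (mul_le_mul (H.bound_left _ _ hθ hγ) h0₁ (norm_nonneg _) hM)
    have h2 := (real_inner_le_norm (gG (u 0).1 (u 0).2) ((u 0).2 - γs)).trans
      (mul_le_mul (H.bound_right _ _ hθ hγ) h0₂ (norm_nonneg _) hM)
    have h3 : 0 ≤ m / 2 * (‖(u 0).1 - θs‖ ^ 2 + ‖(u 0).2 - γs‖ ^ 2) := by positivity
    rw [pow_zero]
    linarith
  | succ t ih =>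
    obtain ⟨i1, i2, i3⟩ := ih
    obtain ⟨s1, s2, s3⟩ := H.step hm hR h₁ h₂ h₁L h₂L h₁M h₂M i1 i2 (hu₁ t) (hu₂ t)
    have s4 : f (u (t + 1)).1 (u (t + 1)).2 - f θs γs
        ≤ (1 - min η₁ η₂ * m / 3) ^ (t + 1) * (2 * M * b) := by
      refine s3.trans ?_
      rw [pow_succ', mul_assoc]
      exact mul_le_mul_of_nonneg_left i3 hρ0
    have s5 : f (u (t + 1)).1 (u (t + 1)).2 - f θs γs ≤ 2 * M * b :=
      s4.trans (mul_le_of_le_one_left (by positivity) (pow_le_one₀ hρ0 hρ1))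
    -- A single step only guarantees radius `R`. The gap has not exceeded `2 * M * b`, so `hsmall`
    -- brings the new iterate back into radius `R / 2` and the induction closes.
    have s6 := H.sq_dist_le hm hE hG s1 s2
    have s7 : ‖(u (t + 1)).1 - θs‖ ^ 2 + ‖(u (t + 1)).2 - γs‖ ^ 2 ≤ (R / 2) ^ 2 := by
      refine le_of_mul_le_mul_left ?_ (by positivity : 0 < m / 4)
      linarith
    refine ⟨?_, ?_, s4⟩
    · exact (sq_le_sq₀ (norm_nonneg _) (by positivity)).1 (by nlinarith [sq_nonneg ‖(u (t + 1)).2 - γs‖])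
    · exact (sq_le_sq₀ (norm_nonneg _) (by positivity)).1 (by nlinarith [sq_nonneg ‖(u (t + 1)).1 - θs‖])

end Descent

/-! ### Local regularity of the empirical loss -/

/-! ### Scalar estimates for the logit shift $\sigma A+\tau P+PA$ -/

section Scalar

variable {B R σ τ A P x y : ℝ}

/-- The bounds that the features and the displacement `(x, y)` put on the logit. -/
structure LocalBounds (B R σ τ A P x y : ℝ) : Prop where
  one_le : 1 ≤ B
  R_nonneg : 0 ≤ R
  R_le : R ≤ 1
  x_nonneg : 0 ≤ x
  y_nonneg : 0 ≤ y
  x_le : x ≤ R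
  y_le : y ≤ R
  σ_le : |σ| ≤ B
  τ_le : |τ| ≤ B
  A_le : |A| ≤ B * x
  P_le : |P| ≤ B * y

theorem LocalBounds.abs_lin_le (h : LocalBounds B R σ τ A P x y) :
    |σ * A + τ * P| ≤ B ^ 2 * (x + y) := by
  have hB : 0 ≤ B := zero_le_one.trans h.one_le
  have h1 := mul_le_mul h.σ_le h.A_le (abs_nonneg _) hB
  have h2 := mul_le_mul h.τ_le h.P_le (abs_nonneg _) hB
  rw [← abs_mul] at h1 h2
  linarith [abs_add_le (σ * A) (τ * P)]

theorem LocalBounds.abs_cross_le (h : LocalBounds B R σ τ A P x y) :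
    |P * A| ≤ B ^ 2 * (x * y) := by
  have hB : 0 ≤ B := zero_le_one.trans h.one_le
  have h1 := mul_le_mul h.P_le h.A_le (abs_nonneg _) (mul_nonneg hB h.y_nonneg)
  rw [← abs_mul] at h1
  linarith

theorem LocalBounds.abs_delta_le (h : LocalBounds B R σ τ A P x y) :
    |σ * A + τ * P + P * A| ≤ 3 * B ^ 2 * R := by
  have h1 := h.abs_lin_le
  have h2 := h.abs_cross_le
  have h3 : x * y ≤ R := by nlinarith [h.x_le, h.y_le, h.x_nonneg, h.y_nonneg, h.R_le]
  have h4 := mul_le_mul_of_nonneg_left (add_le_add (add_le_add h.x_le h.y_le) h3) (sq_nonneg B)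
  linarith [abs_add_le (σ * A + τ * P) (P * A)]

/-- With $l$ the linear part and $q=PA$, the corrections to $\frac w2l^2$ are $wlq$, the nonnegative
$\frac w2q^2$ and the cubic term. The first and last are of third order, so each gains a factor `R`
over $x^2+y^2$. They cost $1$ and $18/2=9$ times $B^6R$, within the 11. -/
theorem LocalBounds.le_bregman (h : LocalBounds B R σ τ A P x y) {w : ℝ} (hw0 : 0 ≤ w)
    (hw1 : w ≤ 1) :
    1 / 2 * w * (σ * A + τ * P) ^ 2 - 11 * B ^ 6 * R * (x ^ 2 + y ^ 2)
      ≤ (w - |σ * A + τ * P + P * A|) / 2 * (σ * A + τ * P + P * A) ^ 2 := by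
  have hl := h.abs_lin_le
  have hq := h.abs_cross_le
  have hd := h.abs_delta_le
  have hx := h.x_nonneg
  have hy := h.y_nonneg
  have hR := h.R_nonneg
  set l := σ * A + τ * P
  set q := P * A
  have hxy : 2 * (x * y) ≤ x ^ 2 + y ^ 2 := by nlinarith [sq_nonneg (x - y)]
  have hB2 : 1 ≤ B ^ 2 := one_le_pow₀ h.one_le
  have hB4 : 0 ≤ B ^ 4 := by positivity
  have hl2 : l ^ 2 ≤ B ^ 4 * (2 * (x ^ 2 + y ^ 2)) := by
    have := pow_le_pow_left₀ (abs_nonneg l) hl 2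
    rw [sq_abs] at this
    nlinarith
  have hq2 : q ^ 2 ≤ B ^ 4 * (x ^ 2 + y ^ 2) := by
    have := pow_le_pow_left₀ (abs_nonneg q) hq 2
    rw [sq_abs] at this
    have h1 : (x * y) ^ 2 ≤ x ^ 2 + y ^ 2 := by
      have : y ^ 2 ≤ 1 := pow_le_one₀ hy (h.y_le.trans h.R_le)
      nlinarith [sq_nonneg x, sq_nonneg y]
    nlinarith
  have hlq : |l * q| ≤ B ^ 4 * (R * (x ^ 2 + y ^ 2)) := by
    rw [abs_mul]
    have h1 := mul_le_mul hl hq (abs_nonneg _) (by positivity)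
    have h2 : (x + y) * (x * y) ≤ R * (x ^ 2 + y ^ 2) := by
      have : x + y ≤ 2 * R := by linarith [h.x_le, h.y_le]
      nlinarith [mul_nonneg hx hy]
    nlinarith
  have hd2 : (l + q) ^ 2 ≤ B ^ 4 * (6 * (x ^ 2 + y ^ 2)) := by
    nlinarith [sq_nonneg (l - q)]
  have hd3 : |l + q| * (l + q) ^ 2 ≤ 18 * B ^ 6 * R * (x ^ 2 + y ^ 2) := by
    have := mul_le_mul hd hd2 (sq_nonneg _) (by positivity)
    linarith
  have hcross : -(w * (l * q)) ≤ B ^ 6 * R * (x ^ 2 + y ^ 2) := by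
    have h1 : -(w * (l * q)) ≤ |l * q| := by
      have := neg_abs_le (l * q)
      nlinarith [abs_nonneg (l * q)]
    have h2 : B ^ 4 * (R * (x ^ 2 + y ^ 2)) ≤ B ^ 6 * R * (x ^ 2 + y ^ 2) := by
      have h3 : 0 ≤ B ^ 4 * (R * (x ^ 2 + y ^ 2)) := by positivity
      nlinarith
    linarith
  have hN : 0 ≤ B ^ 6 * R * (x ^ 2 + y ^ 2) := by positivity
  nlinarith [mul_nonneg hw0 (sq_nonneg q)]

theorem LocalBounds.abs_delta_mul_cross_le (h : LocalBounds B R σ τ A P x y) :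
    |σ * A + τ * P + P * A| * |P * A| ≤ 2 * B ^ 6 * R * (x ^ 2 + y ^ 2) := by
  have hR := h.R_nonneg
  have hx := h.x_nonneg
  have hy := h.y_nonneg
  have h1 := mul_le_mul h.abs_delta_le h.abs_cross_le (abs_nonneg _) (by positivity)
  have hxy : 2 * (x * y) ≤ x ^ 2 + y ^ 2 := by nlinarith [sq_nonneg (x - y)]
  have hB2 : 1 ≤ B ^ 2 := one_le_pow₀ h.one_le
  have h2 : 3 * B ^ 2 * R * (B ^ 2 * (x * y)) ≤ 2 * (B ^ 4 * R * (x ^ 2 + y ^ 2)) := by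
    have h3 : 0 ≤ B ^ 4 * R := by positivity
    nlinarith [mul_nonneg hx hy]
  have h4 : B ^ 4 * R * (x ^ 2 + y ^ 2) ≤ B ^ 6 * R * (x ^ 2 + y ^ 2) := by
    have h3 : 0 ≤ B ^ 4 * R * (x ^ 2 + y ^ 2) := by positivity
    nlinarith
  linarith

/-- Both the weight and the linear form move by an amount proportional to `R`. The weight change
costs 24 and the change of the form 6, which gives the 30. -/
theorem LocalBounds.sq_lin_sub_le (h : LocalBounds B R σ τ A P x y) {w w' A' P' x' y' : ℝ}
    (hw0 : 0 ≤ w') (hw1 : w' ≤ 1) (hw : |w - w'| ≤ |σ * A + τ * P + P * A|)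
    (hx' : 0 ≤ x') (hy' : 0 ≤ y') (hA' : |A'| ≤ B * x') (hP' : |P'| ≤ B * y') :
    w' * (σ * A' + τ * P') ^ 2 - 30 * B ^ 6 * R * (x' ^ 2 + y' ^ 2)
      ≤ w * ((σ + P) * A' + (τ + A) * P') ^ 2 := by
  have hR := h.R_nonneg
  have hB : 0 ≤ B := zero_le_one.trans h.one_le
  have hB2 : 1 ≤ B ^ 2 := one_le_pow₀ h.one_le
  have hxy : (x' + y') ^ 2 ≤ 2 * (x' ^ 2 + y' ^ 2) := by nlinarith [sq_nonneg (x' - y')]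
  have hl' : |σ * A' + τ * P'| ≤ B ^ 2 * (x' + y') := by
    have h1 := mul_le_mul h.σ_le hA' (abs_nonneg _) hB
    have h2 := mul_le_mul h.τ_le hP' (abs_nonneg _) hB
    rw [← abs_mul] at h1 h2
    linarith [abs_add_le (σ * A') (τ * P')]
  have he : |P * A' + A * P'| ≤ B ^ 2 * R * (x' + y') := by
    have h1 := mul_le_mul (h.P_le.trans (mul_le_mul_of_nonneg_left h.y_le hB)) hA' (abs_nonneg _)
      (by positivity)
    have h2 := mul_le_mul (h.A_le.trans (mul_le_mul_of_nonneg_left h.x_le hB)) hP' (abs_nonneg _)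
      (by positivity)
    rw [← abs_mul] at h1 h2
    linarith [abs_add_le (P * A') (A * P')]
  set l := σ * A' + τ * P'
  set e := P * A' + A * P'
  have hsum : (σ + P) * A' + (τ + A) * P' = l + e := by simp only [l, e]; ring
  rw [hsum]
  have he' : |e| ≤ B ^ 2 * (x' + y') := he.trans (by
    have : 0 ≤ B ^ 2 * (x' + y') := by positivity
    nlinarith [h.R_le])
  have hle : |l + e| ≤ 2 * B ^ 2 * (x' + y') := by linarith [abs_add_le l e]
  have hsq : (l + e) ^ 2 ≤ B ^ 4 * (8 * (x' ^ 2 + y' ^ 2)) := by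
    have := pow_le_pow_left₀ (abs_nonneg _) hle 2
    rw [sq_abs] at this
    have h2 := mul_le_mul_of_nonneg_left hxy (by positivity : 0 ≤ 4 * B ^ 4)
    linarith
  have hd := hw.trans h.abs_delta_le
  have t1 : |w - w'| * (l + e) ^ 2 ≤ 24 * B ^ 6 * R * (x' ^ 2 + y' ^ 2) := by
    have := mul_le_mul hd hsq (sq_nonneg _) (by positivity)
    linarith
  have t2 : |e| * |2 * l + e| ≤ 6 * B ^ 4 * R * (x' ^ 2 + y' ^ 2) := by
    have h1 : |2 * l + e| ≤ 3 * B ^ 2 * (x' + y') := by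
      have : |2 * l| = 2 * |l| := by rw [abs_mul, abs_two]
      linarith [abs_add_le (2 * l) e]
    have := mul_le_mul he h1 (abs_nonneg _) (by positivity)
    have h2 := mul_le_mul_of_nonneg_left hxy (by positivity : 0 ≤ 3 * B ^ 4 * R)
    linarith
  have t3 : 6 * B ^ 4 * R * (x' ^ 2 + y' ^ 2) ≤ 6 * B ^ 6 * R * (x' ^ 2 + y' ^ 2) := by
    have : 0 ≤ 6 * B ^ 4 * R * (x' ^ 2 + y' ^ 2) := by positivity
    nlinarith
  rw [← abs_mul] at t2
  have t4 : -(w' * (e * (2 * l + e))) ≤ |e * (2 * l + e)| := by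
    have := neg_abs_le (e * (2 * l + e))
    nlinarith [abs_nonneg (e * (2 * l + e))]
  have t5 : -((w - w') * (l + e) ^ 2) ≤ |w - w'| * (l + e) ^ 2 := by
    have := neg_abs_le (w - w')
    nlinarith [sq_nonneg (l + e)]
  have t6 : w * (l + e) ^ 2 = w' * l ^ 2 + (w - w') * (l + e) ^ 2 + w' * (e * (2 * l + e)) := by
    ring
  linarith

end Scalar

/-! ### Inequalities for the loss of one observation -/

section Observation

variable {X S A : Type*} {d₁ d₂ : ℕ} (F : Features X S A d₁ d₂)

/-- A common bound `B ≥ 1` for the features and for the two factors of the true logit. -/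
structure FeatureBound (θs : Vec d₁) (γs : Vec d₂) (B : ℝ) : Prop where
  one_le : 1 ≤ B
  featDiff_le : ∀ o, ‖featDiff F o‖ ≤ B
  psi_le : ∀ x, ‖F.psi x‖ ≤ B
  scale_le : ∀ x, |scale F γs x| ≤ B
  inner_le : ∀ o, |inner ℝ θs (featDiff F o)| ≤ B

/-- The differential of the logit at `(θ, γ)` in the direction `(a, c)`. -/
noncomputable def logitDiff (θ : Vec d₁) (γ : Vec d₂) (a : Vec d₁) (c : Vec d₂)
    (o : Obs X S A) : ℝ :=
  scale F γ (ctx o) * inner ℝ a (featDiff F o) + inner ℝ θ (featDiff F o) * inner ℝ c (F.psi (ctx o))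

/-- The second-order part of the logit in the direction `(a, c)`. -/
noncomputable def logitCross (a : Vec d₁) (c : Vec d₂) (o : Obs X S A) : ℝ :=
  inner ℝ c (F.psi (ctx o)) * inner ℝ a (featDiff F o)

variable {F} {θs : Vec d₁} {γs : Vec d₂} {B : ℝ}

theorem abs_inner_le_of_norm_le {d : ℕ} {u v : Vec d} (hv : ‖v‖ ≤ B) :
    |inner ℝ u v| ≤ B * ‖u‖ := by
  rw [mul_comm]
  exact (abs_real_inner_le_norm u v).trans (mul_le_mul_of_nonneg_left hv (norm_nonneg _))

theorem FeatureBound.localBounds (H : FeatureBound F θs γs B) {R : ℝ} (hR : R ≤ 1)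
    {θ : Vec d₁} {γ : Vec d₂} (hθ : ‖θ - θs‖ ≤ R) (hγ : ‖γ - γs‖ ≤ R) (o : Obs X S A) :
    LocalBounds B R (scale F γs (ctx o)) (inner ℝ θs (featDiff F o))
      (inner ℝ (θ - θs) (featDiff F o)) (inner ℝ (γ - γs) (F.psi (ctx o)))
      ‖θ - θs‖ ‖γ - γs‖ where
  one_le := H.one_le
  R_nonneg := (norm_nonneg _).trans hθ
  R_le := hR
  x_nonneg := norm_nonneg _
  y_nonneg := norm_nonneg _
  x_le := hθ
  y_le := hγ
  σ_le := H.scale_le _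
  τ_le := H.inner_le _
  A_le := abs_inner_le_of_norm_le (H.featDiff_le o)
  P_le := abs_inner_le_of_norm_le (H.psi_le _)

theorem scale_eq_add (γ : Vec d₂) (x : X) :
    scale F γ x = scale F γs x + inner ℝ (γ - γs) (F.psi x) := by
  simp only [scale, inner_sub_left]; ring

theorem inner_eq_add (θ : Vec d₁) (z : Vec d₁) :
    inner ℝ θ z = inner ℝ θs z + inner ℝ (θ - θs) z := by
  simp only [inner_sub_left]; ring

theorem logit_sub (θ : Vec d₁) (γ : Vec d₂) (o : Obs X S A) :
    logit F θ γ o - logit F θs γs o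
      = logitDiff F θs γs (θ - θs) (γ - γs) o + logitCross F (θ - θs) (γ - γs) o := by
  rw [logit_eq, logit_eq, scale_eq_add (γs := γs) γ, inner_eq_add (θs := θs) θ, logitDiff,
    logitCross]
  ring

theorem inner_scoreT (o : Obs X S A) (θ : Vec d₁) (γ : Vec d₂) (a : Vec d₁) :
    inner ℝ (scoreT F o θ γ) a
      = residual F θ γ o * (scale F γ (ctx o) * inner ℝ a (featDiff F o)) := by
  rw [scoreT, real_inner_smul_left, real_inner_comm, mul_assoc]

theorem inner_scoreG (o : Obs X S A) (θ : Vec d₁) (γ : Vec d₂) (c : Vec d₂) :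
    inner ℝ (scoreG F o θ γ) c
      = residual F θ γ o * (inner ℝ θ (featDiff F o) * inner ℝ c (F.psi (ctx o))) := by
  rw [scoreG, real_inner_smul_left, real_inner_comm c, mul_assoc]

/-- The scores at the truth see only the linear part of the logit shift, so its product part
remains, multiplied by the residual. That term is kept exactly, because only its average over the
sample is small. -/
theorem FeatureBound.tangent_center (H : FeatureBound F θs γs B) {R : ℝ} (hR : R ≤ 1)
    {θ : Vec d₁} {γ : Vec d₂} (hθ : ‖θ - θs‖ ≤ R) (hγ : ‖γ - γs‖ ≤ R) (o : Obs X S A) :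
    obsLoss F o θs γs + inner ℝ (scoreT F o θs γs) (θ - θs) + inner ℝ (scoreG F o θs γs) (γ - γs)
      + (1 / 2 * (logitVar F θs γs o * logitDiff F θs γs (θ - θs) (γ - γs) o ^ 2)
        + residual F θs γs o * logitCross F (θ - θs) (γ - γs) o
        - 13 * B ^ 6 * R * (‖θ - θs‖ ^ 2 + ‖γ - γs‖ ^ 2)) ≤ obsLoss F o θ γ := by
  have hb := H.localBounds hR hθ hγ o
  have h1 := le_softplus (logit F θ γ o) (logit F θs γs o) (logit F θs γs o) Set.right_mem_uIcc
  have h2 := hb.le_bregman (sigmoidVar_pos (logit F θs γs o)).le (sigmoidVar_le_one _)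
  have hN : 0 ≤ B ^ 6 * R * (‖θ - θs‖ ^ 2 + ‖γ - γs‖ ^ 2) := by
    have := hb.R_nonneg
    positivity
  rw [logit_sub (θs := θs) (γs := γs)] at h1
  have h3 := logit_sub (F := F) (θs := θs) (γs := γs) θ γ o
  rw [inner_scoreT, inner_scoreG, obsLoss_eq, obsLoss_eq, residual, logitVar_eq]
  unfold logitDiff logitCross at h1 h3 ⊢
  have h4 : logit F θ γ o = logit F θs γs o + (logit F θ γ o - logit F θs γs o) := by ring
  rw [h3] at h4
  have h5 := congrArg (fun t => label o * t) h4
  linarith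

theorem FeatureBound.tangent_point (H : FeatureBound F θs γs B) {R : ℝ} (hR : R ≤ 1)
    {θ : Vec d₁} {γ : Vec d₂} (hθ : ‖θ - θs‖ ≤ R) (hγ : ‖γ - γs‖ ≤ R) (o : Obs X S A) :
    obsLoss F o θ γ
      + (1 / 2 * (logitVar F θs γs o * logitDiff F θs γs (θ - θs) (γ - γs) o ^ 2)
        + residual F θs γs o * logitCross F (θ - θs) (γ - γs) o
        - 13 * B ^ 6 * R * (‖θ - θs‖ ^ 2 + ‖γ - γs‖ ^ 2))
      ≤ obsLoss F o θs γs + inner ℝ (scoreT F o θ γ) (θ - θs)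
        + inner ℝ (scoreG F o θ γ) (γ - γs) := by
  have hb := H.localBounds hR hθ hγ o
  -- The tangent is now taken at the nearby point, but the curvature is still read off at the true
  -- logit. Both tangent inequalities thus involve the same information form.
  have h1 := le_softplus (logit F θs γs o) (logit F θ γ o) (logit F θs γs o) Set.left_mem_uIcc
  have h2 := hb.le_bregman (sigmoidVar_pos (logit F θs γs o)).le (sigmoidVar_le_one _)
  have h3 := logit_sub (F := F) (θs := θs) (γs := γs) θ γ o
  have h0 : logit F θs γs o - logit F θ γ o = -(logit F θ γ o - logit F θs γs o) := by ring
  rw [h0, abs_neg, neg_sq, h3] at h1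
  have h6 := hb.abs_delta_mul_cross_le
  -- The scores at $(\theta,\gamma)$ count the product part twice and the logit shift counts it
  -- once. The surplus carries the residual at $(\theta,\gamma)$; replacing that by the residual at
  -- the truth costs 2, hence $13=11+2$.
  have h7 : |(Real.sigmoid (logit F θ γ o) - Real.sigmoid (logit F θs γs o))
      * logitCross F (θ - θs) (γ - γs) o|
      ≤ |logitDiff F θs γs (θ - θs) (γ - γs) o + logitCross F (θ - θs) (γ - γs) o|
        * |logitCross F (θ - θs) (γ - γs) o| := by
    rw [abs_mul, ← h3]
    exact mul_le_mul_of_nonneg_right (abs_sigmoid_sub_le _ _) (abs_nonneg _)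
  have h8 := neg_le_of_abs_le h7
  rw [inner_scoreT, inner_scoreG, obsLoss_eq, obsLoss_eq, residual, residual, logitVar_eq,
    scale_eq_add (γs := γs) γ, inner_eq_add (θs := θs) θ]
  unfold logitDiff logitCross at h1 h3 h8 ⊢
  have h4 : logit F θ γ o = logit F θs γs o + (logit F θ γ o - logit F θs γs o) := by ring
  rw [h3] at h4
  have h5 := congrArg (fun t => label o * t) h4
  linarith

theorem FeatureBound.abs_scale_le (H : FeatureBound F θs γs B) {R : ℝ} (hR : R ≤ 1)
    {γ : Vec d₂} (hγ : ‖γ - γs‖ ≤ R) (x : X) : |scale F γ x| ≤ 2 * B := by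
  rw [scale_eq_add (γs := γs)]
  have h1 := abs_inner_le_of_norm_le (u := γ - γs) (H.psi_le x)
  have h2 : B * ‖γ - γs‖ ≤ B := mul_le_of_le_one_right (by linarith [H.one_le]) (hγ.trans hR)
  linarith [abs_add_le (scale F γs x) (inner ℝ (γ - γs) (F.psi x)), H.scale_le x]

theorem FeatureBound.abs_inner_le (H : FeatureBound F θs γs B) {R : ℝ} (hR : R ≤ 1)
    {θ : Vec d₁} (hθ : ‖θ - θs‖ ≤ R) (o : Obs X S A) : |inner ℝ θ (featDiff F o)| ≤ 2 * B := by
  rw [inner_eq_add (θs := θs)]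
  have h1 := abs_inner_le_of_norm_le (u := θ - θs) (H.featDiff_le o)
  have h2 : B * ‖θ - θs‖ ≤ B := mul_le_of_le_one_right (by linarith [H.one_le]) (hθ.trans hR)
  linarith [abs_add_le (inner ℝ θs (featDiff F o)) (inner ℝ (θ - θs) (featDiff F o)),
    H.inner_le o]

theorem softplus_sub_mul_le (a b y : ℝ) :
    softplus a - y * a
      ≤ softplus b - y * b + (Real.sigmoid b - y) * (a - b) + 1 / 2 * (a - b) ^ 2 := by
  linarith [softplus_le a b]

theorem sq_mul_inner_le {d : ℕ} {u v : Vec d} {s : ℝ} (hB : 0 ≤ B) (hs : |s| ≤ 2 * B)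
    (hv : ‖v‖ ≤ B) : (s * inner ℝ u v) ^ 2 ≤ 4 * B ^ 4 * ‖u‖ ^ 2 := by
  have h := mul_le_mul hs (abs_inner_le_of_norm_le (u := u) hv) (abs_nonneg _) (by positivity)
  rw [← abs_mul] at h
  have := pow_le_pow_left₀ (abs_nonneg _) h 2
  rw [sq_abs] at this
  linarith

/-- With one block fixed the logit is affine in the other, so the quadratic upper bound for softplus
transfers. Here $4B^4$ would do; $5B^4$ is the constant shared with `FeatureBound.lipschitz_right`,
where the change of the residual gives $4B^4$ and that of the reward difference $B^2\le B^4$. -/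
theorem FeatureBound.smooth_left (H : FeatureBound F θs γs B) {R : ℝ} (hR : R ≤ 1)
    (θ θ' : Vec d₁) {γ : Vec d₂} (hγ : ‖γ - γs‖ ≤ R) (o : Obs X S A) :
    obsLoss F o θ' γ ≤ obsLoss F o θ γ + inner ℝ (scoreT F o θ γ) (θ' - θ)
      + 5 * B ^ 4 / 2 * ‖θ' - θ‖ ^ 2 := by
  have hB : 0 ≤ B := by linarith [H.one_le]
  have h1 := softplus_sub_mul_le (logit F θ' γ o) (logit F θ γ o) (label o)
  have h2 : logit F θ' γ o - logit F θ γ o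
      = scale F γ (ctx o) * inner ℝ (θ' - θ) (featDiff F o) := by
    rw [logit_eq, logit_eq, inner_sub_left]; ring
  have h3 := sq_mul_inner_le (u := θ' - θ) hB (H.abs_scale_le hR hγ (ctx o)) (H.featDiff_le o)
  rw [h2] at h1
  rw [inner_scoreT, obsLoss_eq, obsLoss_eq, residual]
  have : 0 ≤ B ^ 4 * ‖θ' - θ‖ ^ 2 := by positivity
  linarith

theorem FeatureBound.smooth_right (H : FeatureBound F θs γs B) {R : ℝ} (hR : R ≤ 1)
    {θ : Vec d₁} (hθ : ‖θ - θs‖ ≤ R) (γ γ' : Vec d₂) (o : Obs X S A) :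
    obsLoss F o θ γ' ≤ obsLoss F o θ γ + inner ℝ (scoreG F o θ γ) (γ' - γ)
      + 5 * B ^ 4 / 2 * ‖γ' - γ‖ ^ 2 := by
  have hB : 0 ≤ B := by linarith [H.one_le]
  have h1 := softplus_sub_mul_le (logit F θ γ' o) (logit F θ γ o) (label o)
  have h2 : logit F θ γ' o - logit F θ γ o
      = inner ℝ θ (featDiff F o) * inner ℝ (γ' - γ) (F.psi (ctx o)) := by
    rw [logit_eq, logit_eq, scale_eq_add (γs := γ) γ']; ring
  have h3 := sq_mul_inner_le (u := γ' - γ) hB (H.abs_inner_le hR hθ o) (H.psi_le (ctx o))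
  rw [h2] at h1
  rw [inner_scoreG, obsLoss_eq, obsLoss_eq, residual]
  have : 0 ≤ B ^ 4 * ‖γ' - γ‖ ^ 2 := by positivity
  linarith

theorem FeatureBound.lipschitz_right (H : FeatureBound F θs γs B) {R : ℝ} (hR : R ≤ 1)
    {θ θ' : Vec d₁} {γ : Vec d₂} (hθ : ‖θ - θs‖ ≤ R) (hγ : ‖γ - γs‖ ≤ R) (o : Obs X S A) :
    ‖scoreG F o θ γ - scoreG F o θ' γ‖ ≤ 5 * B ^ 4 * ‖θ - θ'‖ := by
  have hB : 0 ≤ B := by linarith [H.one_le]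
  have hB2 : 1 ≤ B ^ 2 := one_le_pow₀ H.one_le
  have h2 : logit F θ γ o - logit F θ' γ o
      = scale F γ (ctx o) * inner ℝ (θ - θ') (featDiff F o) := by
    rw [logit_eq, logit_eq, inner_sub_left]; ring
  have hA := abs_inner_le_of_norm_le (u := θ - θ') (H.featDiff_le o)
  have h3 : |residual F θ γ o - residual F θ' γ o| ≤ 2 * B * (B * ‖θ - θ'‖) := by
    have h4 : residual F θ γ o - residual F θ' γ o
        = Real.sigmoid (logit F θ γ o) - Real.sigmoid (logit F θ' γ o) := by
      unfold residual; ring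
    rw [h4]
    refine (abs_sigmoid_sub_le _ _).trans ?_
    rw [h2, abs_mul]
    exact mul_le_mul (H.abs_scale_le hR hγ _) hA (abs_nonneg _) (by positivity)
  have h5 : residual F θ γ o * inner ℝ θ (featDiff F o)
      - residual F θ' γ o * inner ℝ θ' (featDiff F o)
      = (residual F θ γ o - residual F θ' γ o) * inner ℝ θ (featDiff F o)
        + residual F θ' γ o * inner ℝ (θ - θ') (featDiff F o) := by
    rw [inner_sub_left]; ring
  have h6 : |residual F θ γ o * inner ℝ θ (featDiff F o)
      - residual F θ' γ o * inner ℝ θ' (featDiff F o)|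
      ≤ 2 * B * (B * ‖θ - θ'‖) * (2 * B) + 1 * (B * ‖θ - θ'‖) := by
    rw [h5]
    refine (abs_add_le _ _).trans (add_le_add ?_ ?_)
    · rw [abs_mul]
      exact mul_le_mul h3 (H.abs_inner_le hR hθ o) (abs_nonneg _) (by positivity)
    · rw [abs_mul]
      exact mul_le_mul (abs_residual_le_one F θ' γ o) hA (abs_nonneg _) zero_le_one
  rw [scoreG, scoreG, ← sub_smul, norm_smul, Real.norm_eq_abs]
  refine (mul_le_mul h6 (H.psi_le _) (norm_nonneg _) (by positivity)).trans ?_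
  have : 0 ≤ B ^ 2 * ‖θ - θ'‖ := by positivity
  nlinarith

theorem FeatureBound.norm_scoreT_le (H : FeatureBound F θs γs B) {R : ℝ} (hR : R ≤ 1)
    (θ : Vec d₁) {γ : Vec d₂} (hγ : ‖γ - γs‖ ≤ R) (o : Obs X S A) :
    ‖scoreT F o θ γ‖ ≤ 2 * B ^ 2 := by
  have hB : 0 ≤ B := by linarith [H.one_le]
  rw [scoreT, norm_smul, Real.norm_eq_abs, abs_mul]
  have h := mul_le_mul (abs_residual_le_one F θ γ o) (H.abs_scale_le hR hγ (ctx o))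
    (abs_nonneg _) zero_le_one
  exact (mul_le_mul h (H.featDiff_le o) (norm_nonneg _) (by positivity)).trans_eq (by ring)

theorem FeatureBound.norm_scoreG_le (H : FeatureBound F θs γs B) {R : ℝ} (hR : R ≤ 1)
    {θ : Vec d₁} (γ : Vec d₂) (hθ : ‖θ - θs‖ ≤ R) (o : Obs X S A) :
    ‖scoreG F o θ γ‖ ≤ 2 * B ^ 2 := by
  have hB : 0 ≤ B := by linarith [H.one_le]
  rw [scoreG, norm_smul, Real.norm_eq_abs, abs_mul]
  have h := mul_le_mul (abs_residual_le_one F θ γ o) (H.abs_inner_le hR hθ o)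
    (abs_nonneg _) zero_le_one
  exact (mul_le_mul h (H.psi_le _) (norm_nonneg _) (by positivity)).trans_eq (by ring)

/-- The information form at a nearby point is bounded below by the one at the centre. -/
theorem FeatureBound.le_logitDiff_sq (H : FeatureBound F θs γs B) {R : ℝ} (hR : R ≤ 1)
    {θ : Vec d₁} {γ : Vec d₂} (hθ : ‖θ - θs‖ ≤ R) (hγ : ‖γ - γs‖ ≤ R) (a : Vec d₁) (c : Vec d₂)
    (o : Obs X S A) :
    logitVar F θs γs o * logitDiff F θs γs a c o ^ 2 - 30 * B ^ 6 * R * (‖a‖ ^ 2 + ‖c‖ ^ 2)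
      ≤ logitVar F θ γ o * logitDiff F θ γ a c o ^ 2 := by
  have hb := H.localBounds hR hθ hγ o
  have h := hb.sq_lin_sub_le (w := logitVar F θ γ o) (w' := logitVar F θs γs o)
    (sigmoidVar_pos _).le (sigmoidVar_le_one _)
    (by
      refine (abs_sigmoidVar_sub_le _ _).trans_eq ?_
      rw [logit_sub (θs := θs) (γs := γs)]
      rfl)
    (norm_nonneg a) (norm_nonneg c) (abs_inner_le_of_norm_le (H.featDiff_le o))
    (abs_inner_le_of_norm_le (H.psi_le (ctx o)))
  unfold logitDiff
  rwa [scale_eq_add (γs := γs) γ, inner_eq_add (θs := θs) θ]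

end Observation

/-! ### Averages over a data set -/

section Average

variable {Ω : Type*} {n : ℕ}

/-- The average of `h` over the data set `D`. -/
noncomputable def avg (D : Fin n → Ω) (h : Ω → ℝ) : ℝ := (1 / (n : ℝ)) * ∑ i, h (D i)

variable (D : Fin n → Ω)

theorem avg_add (g h : Ω → ℝ) : avg D (fun o => g o + h o) = avg D g + avg D h := by
  simp only [avg, Finset.sum_add_distrib, mul_add]

theorem avg_sub (g h : Ω → ℝ) : avg D (fun o => g o - h o) = avg D g - avg D h := by
  simp only [avg, Finset.sum_sub_distrib, mul_sub]

theorem avg_const_mul (r : ℝ) (h : Ω → ℝ) : avg D (fun o => r * h o) = r * avg D h := by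
  simp only [avg, ← Finset.mul_sum]; ring

theorem avg_sum {ι : Type*} (s : Finset ι) (h : ι → Ω → ℝ) :
    avg D (fun o => ∑ j ∈ s, h j o) = ∑ j ∈ s, avg D (h j) := by
  simp only [avg]
  rw [Finset.sum_comm, Finset.mul_sum]

theorem avg_const (hn : n ≠ 0) (r : ℝ) : avg D (fun _ => r) = r := by
  have : (n : ℝ) ≠ 0 := Nat.cast_ne_zero.2 hn
  simp [avg, this]

theorem avg_mono {g h : Ω → ℝ} (H : ∀ o, g o ≤ h o) : avg D g ≤ avg D h :=
  mul_le_mul_of_nonneg_left (Finset.sum_le_sum fun i _ => H (D i)) (by positivity)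

theorem norm_avg_smul_le {E : Type*} [NormedAddCommGroup E] [NormedSpace ℝ E] (hn : n ≠ 0)
    {g : Ω → E} {C : ℝ} (H : ∀ o, ‖g o‖ ≤ C) : ‖(1 / (n : ℝ)) • ∑ i, g (D i)‖ ≤ C := by
  rw [norm_smul, Real.norm_of_nonneg (by positivity)]
  refine (mul_le_mul_of_nonneg_left (norm_sum_le _ _) (by positivity)).trans ?_
  exact (avg_mono D H).trans_eq (avg_const D hn C)

end Average

/-! ### From single observations to the empirical loss -/

section EmpiricalLoss

variable {X S A : Type*} {d₁ d₂ : ℕ} {F : Features X S A d₁ d₂} {n : ℕ}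
  (D : Fin n → Obs X S A)

theorem inner_empScoreT (θ : Vec d₁) (γ : Vec d₂) (a : Vec d₁) :
    inner ℝ (empScoreT F D θ γ) a = avg D fun o => inner ℝ (scoreT F o θ γ) a := by
  rw [empScoreT, real_inner_smul_left, sum_inner, avg]

theorem inner_empScoreG (θ : Vec d₁) (γ : Vec d₂) (c : Vec d₂) :
    inner ℝ (empScoreG F D θ γ) c = avg D fun o => inner ℝ (scoreG F o θ γ) c := by
  rw [empScoreG, real_inner_smul_left, sum_inner, avg]

theorem empLoss_eq_avg (θ : Vec d₁) (γ : Vec d₂) :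
    empLoss F D θ γ = avg D fun o => obsLoss F o θ γ := rfl

variable {θs : Vec d₁} {γs : Vec d₂} {B : ℝ}

/-- If the empirical information at the truth is well conditioned and the empirical residual cross
term is small, then the empirical loss is regular near the truth. -/
theorem FeatureBound.locallyRegular_empLoss (H : FeatureBound F θs γs B) (hn : n ≠ 0)
    {R m : ℝ} (hR : R ≤ 1) (hRm : 13 * B ^ 6 * R ≤ m / 8)
    (hinfo : ∀ a c, m * (‖a‖ ^ 2 + ‖c‖ ^ 2)
      ≤ avg D fun o => logitVar F θs γs o * logitDiff F θs γs a c o ^ 2)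
    (hcross : ∀ a c, |avg D fun o => residual F θs γs o * logitCross F a c o|
      ≤ m / 4 * (‖a‖ ^ 2 + ‖c‖ ^ 2)) :
    LocallyRegular (empLoss F D) (empScoreT F D) (empScoreG F D) θs γs R (m / 4)
      (5 * B ^ 4) (2 * B ^ 2) where
  tangent_center θ γ hθ hγ := by
    have h := avg_mono D fun o => H.tangent_center hR hθ hγ o
    simp only [avg_add, avg_sub, avg_const_mul, avg_const D hn] at h
    rw [inner_empScoreT, inner_empScoreG, empLoss_eq_avg, empLoss_eq_avg]
    -- Budget: $m/2$ from the information, minus $m/4$ for the residual cross term and $m/8$ for the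
    -- third-order error, leaves $m/8$, half of the modulus $m/4$.
    have h1 := hinfo (θ - θs) (γ - γs)
    have h2 := neg_le_of_abs_le (hcross (θ - θs) (γ - γs))
    have h3 := mul_le_mul_of_nonneg_right hRm
      (by positivity : 0 ≤ ‖θ - θs‖ ^ 2 + ‖γ - γs‖ ^ 2)
    linarith
  tangent_point θ γ hθ hγ := by
    have h := avg_mono D fun o => H.tangent_point hR hθ hγ o
    simp only [avg_add, avg_sub, avg_const_mul, avg_const D hn] at h
    rw [inner_empScoreT, inner_empScoreG, empLoss_eq_avg, empLoss_eq_avg]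
    have h1 := hinfo (θ - θs) (γ - γs)
    have h2 := neg_le_of_abs_le (hcross (θ - θs) (γ - γs))
    have h3 := mul_le_mul_of_nonneg_right hRm
      (by positivity : 0 ≤ ‖θ - θs‖ ^ 2 + ‖γ - γs‖ ^ 2)
    linarith
  smooth_left θ θ' γ _ hγ := by
    have h := avg_mono D fun o => H.smooth_left hR θ θ' hγ o
    simp only [avg_add, avg_const D hn] at h
    rwa [inner_empScoreT, empLoss_eq_avg, empLoss_eq_avg]
  smooth_right θ γ γ' hθ _ := by
    have h := avg_mono D fun o => H.smooth_right hR hθ γ γ' o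
    simp only [avg_add, avg_const D hn] at h
    rwa [inner_empScoreG, empLoss_eq_avg, empLoss_eq_avg]
  lipschitz_right θ θ' γ hθ _ hγ := by
    rw [empScoreG, empScoreG, ← smul_sub, ← Finset.sum_sub_distrib]
    exact norm_avg_smul_le D hn (g := fun o => scoreG F o θ γ - scoreG F o θ' γ)
      fun o => H.lipschitz_right hR hθ hγ o
  bound_left θ γ _ hγ := norm_avg_smul_le D hn fun o => H.norm_scoreT_le hR θ hγ o
  bound_right θ γ hθ _ := norm_avg_smul_le D hn fun o => H.norm_scoreG_le hR γ hθ o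

end EmpiricalLoss

/-! ### Positive definite matrices and Schur complements -/

section MatrixLemmas

open Matrix

theorem isHermitian_fromBlocks_transpose_iff {m n : Type*} [Fintype n] [DecidableEq n]
    (A : Matrix m m ℝ) (B : Matrix m n ℝ)
    {D : Matrix n n ℝ} (hD : D.PosDef) :
    (fromBlocks A B Bᵀ D).IsHermitian ↔ (A - B * D⁻¹ * Bᵀ).IsHermitian := by
  have h := IsHermitian.fromBlocks₂₂ A B hD.isHermitian
  rwa [conjTranspose_eq_transpose_of_trivial] at h

theorem posDef_right_of_fromBlocks {m n : Type*} {A : Matrix m m ℝ} {B : Matrix m n ℝ}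
    {D : Matrix n n ℝ} (h : (fromBlocks A B Bᵀ D).PosDef) : D.PosDef := by
  have := h.submatrix (e := Sum.inr) Sum.inr_injective
  rwa [show (fromBlocks A B Bᵀ D).submatrix Sum.inr Sum.inr = D from rfl] at this

variable {m n ι : Type*} [Fintype m] [Fintype n] [Fintype ι]

/-- Completing the square in `y`. Taking $y=-D^{-1}B^\top x$ makes the square vanish and isolates
the Schur complement; taking $y=0$ shows that the complement is dominated by `A`. -/
theorem dotProduct_fromBlocks_schur [DecidableEq n] (A : Matrix m m ℝ) (B : Matrix m n ℝ)
    {D : Matrix n n ℝ} (hD : D.PosDef) (x : m → ℝ) (y : n → ℝ) :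
    Sum.elim x y ⬝ᵥ (fromBlocks A B Bᵀ D *ᵥ Sum.elim x y) =
      ((D⁻¹ * Bᵀ) *ᵥ x + y) ⬝ᵥ (D *ᵥ ((D⁻¹ * Bᵀ) *ᵥ x + y))
        + x ⬝ᵥ ((A - B * D⁻¹ * Bᵀ) *ᵥ x) := by
  have := hD.isUnit.invertible
  have h := schur_complement_eq₂₂ A B x y hD.isHermitian
  simpa only [star_trivial, conjTranspose_eq_transpose_of_trivial, ← dotProduct_mulVec] using h

theorem posDef_fromBlocks_of_schur [DecidableEq n] {A : Matrix m m ℝ} {B : Matrix m n ℝ}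
    {D : Matrix n n ℝ} (hD : D.PosDef) (hS : (A - B * D⁻¹ * Bᵀ).PosDef) :
    (fromBlocks A B Bᵀ D).PosDef := by
  refine PosDef.of_dotProduct_mulVec_pos
    ((isHermitian_fromBlocks_transpose_iff A B hD).2 hS.isHermitian) fun v hv => ?_
  obtain ⟨x, y, rfl⟩ : ∃ x y, v = Sum.elim x y :=
    ⟨v ∘ Sum.inl, v ∘ Sum.inr, (Sum.elim_comp_inl_inr v).symm⟩
  rw [star_trivial, dotProduct_fromBlocks_schur A B hD]
  have h1 := hD.posSemidef.dotProduct_mulVec_nonneg ((D⁻¹ * Bᵀ) *ᵥ x + y)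
  have h2 := hS.posSemidef.dotProduct_mulVec_nonneg x
  rw [star_trivial] at h1 h2
  by_cases hx : x = 0
  · subst hx
    have hy : y ≠ 0 := by
      rintro rfl
      exact hv (by ext i; cases i <;> rfl)
    have h3 := hD.dotProduct_mulVec_pos hy
    rw [star_trivial] at h3
    simpa using h3
  · have h3 := hS.dotProduct_mulVec_pos hx
    rw [star_trivial] at h3
    linarith

theorem posDef_schur_of_fromBlocks [DecidableEq n] {A : Matrix m m ℝ} {B : Matrix m n ℝ}
    {D : Matrix n n ℝ} (h : (fromBlocks A B Bᵀ D).PosDef) :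
    (A - B * D⁻¹ * Bᵀ).PosDef := by
  have hD := posDef_right_of_fromBlocks h
  refine PosDef.of_dotProduct_mulVec_pos
    ((isHermitian_fromBlocks_transpose_iff A B hD).1 h.isHermitian) fun x hx => ?_
  have hv : Sum.elim x (-((D⁻¹ * Bᵀ) *ᵥ x)) ≠ 0 := by
    intro h0
    exact hx (funext fun i => congrFun h0 (Sum.inl i))
  have h1 := h.dotProduct_mulVec_pos hv
  rw [star_trivial, dotProduct_fromBlocks_schur A B hD, add_neg_cancel, zero_dotProduct,
    zero_add] at h1
  rwa [star_trivial]

theorem dotProduct_schur_le [DecidableEq n] (A : Matrix m m ℝ) (B : Matrix m n ℝ)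
    {D : Matrix n n ℝ} (hD : D.PosDef) (x : m → ℝ) :
    x ⬝ᵥ ((A - B * D⁻¹ * Bᵀ) *ᵥ x) ≤ x ⬝ᵥ (A *ᵥ x) := by
  have h := dotProduct_fromBlocks_schur A B hD x 0
  have h1 := hD.posSemidef.dotProduct_mulVec_nonneg ((D⁻¹ * Bᵀ) *ᵥ x + 0)
  rw [star_trivial] at h1
  have h2 : Sum.elim x 0 ⬝ᵥ (fromBlocks A B Bᵀ D *ᵥ Sum.elim x 0) = x ⬝ᵥ (A *ᵥ x) := by
    rw [fromBlocks_mulVec]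
    simp
  linarith

/-- The quadratic form attains a positive minimum on the compact unit sphere, and homogeneity does
the rest. An empty index type has an empty sphere and is treated apart. -/
theorem exists_coercive_of_posDef {M : Matrix ι ι ℝ} (hM : M.PosDef) :
    ∃ c > 0, ∀ x : ι → ℝ, c * ∑ i, x i ^ 2 ≤ x ⬝ᵥ (M *ᵥ x) := by
  classical
  let f : EuclideanSpace ℝ ι → ℝ := fun x => x.ofLp ⬝ᵥ (M *ᵥ x.ofLp)
  have hf : Continuous f := by
    simp only [f, dotProduct, mulVec]
    fun_prop
  have hs : IsCompact (Metric.sphere (0 : EuclideanSpace ℝ ι) 1) := isCompact_sphere 0 1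
  rcases (Metric.sphere (0 : EuclideanSpace ℝ ι) 1).eq_empty_or_nonempty with he | hne
  · refine ⟨1, one_pos, fun x => ?_⟩
    have hx : WithLp.toLp 2 x = 0 := by
      by_contra hx
      have : (‖WithLp.toLp 2 x‖⁻¹ • WithLp.toLp 2 x : EuclideanSpace ℝ ι)
          ∈ Metric.sphere (0 : EuclideanSpace ℝ ι) 1 := by
        simp [norm_smul, hx]
      rw [he] at this
      exact this
    have hx' : x = 0 := by simpa using hx
    simp [hx']
  · obtain ⟨u, hu, hmin⟩ := hs.exists_isMinOn hne hf.continuousOn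
    have hu0 : u.ofLp ≠ 0 := by
      intro h0
      have : u = 0 := by ext i; exact congrFun h0 i
      simp [this] at hu
    have hpos := hM.dotProduct_mulVec_pos hu0
    rw [star_trivial] at hpos
    refine ⟨f u, hpos, fun x => ?_⟩
    by_cases hx : x = 0
    · simp [hx]
    have hx0 : (WithLp.toLp 2 x : EuclideanSpace ℝ ι) ≠ 0 := by simpa using hx
    set r := ‖(WithLp.toLp 2 x : EuclideanSpace ℝ ι)‖ with hr
    have hr0 : 0 < r := norm_pos_iff.2 hx0
    have hmem : (r⁻¹ • WithLp.toLp 2 x : EuclideanSpace ℝ ι)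
        ∈ Metric.sphere (0 : EuclideanSpace ℝ ι) 1 := by
      simp [norm_smul, ← hr, abs_of_pos hr0, hr0.ne']
    have h1 := isMinOn_iff.1 hmin _ hmem
    have h2 : f (r⁻¹ • WithLp.toLp 2 x) = r⁻¹ * (r⁻¹ * (x ⬝ᵥ (M *ᵥ x))) := by
      simp [f, mulVec_smul, smul_dotProduct, dotProduct_smul]
    rw [h2] at h1
    have h3 : ∑ i, x i ^ 2 = r ^ 2 := by
      rw [hr, EuclideanSpace.real_norm_sq_eq]
    rw [h3]
    calc f u * r ^ 2 ≤ r⁻¹ * (r⁻¹ * (x ⬝ᵥ (M *ᵥ x))) * r ^ 2 := by gcongr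
      _ = x ⬝ᵥ (M *ᵥ x) := by field_simp

theorem abs_dotProduct_mulVec_le {M : Matrix m n ℝ} {ε : ℝ} (hM : ∀ j k, |M j k| ≤ ε)
    (x : m → ℝ) (y : n → ℝ) :
    |x ⬝ᵥ (M *ᵥ y)| ≤ ε * ((∑ j, |x j|) * ∑ k, |y k|) := by
  have h : ∀ j, |(M *ᵥ y) j| ≤ ε * ∑ k, |y k| := fun j => by
    rw [Finset.mul_sum]
    refine (Finset.abs_sum_le_sum_abs _ _).trans (Finset.sum_le_sum fun k _ => ?_)
    rw [abs_mul]
    exact mul_le_mul_of_nonneg_right (hM j k) (abs_nonneg _)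
  calc |x ⬝ᵥ (M *ᵥ y)| ≤ ∑ j, |x j| * (ε * ∑ k, |y k|) :=
        (Finset.abs_sum_le_sum_abs _ _).trans (Finset.sum_le_sum fun j _ => by
          rw [abs_mul]
          exact mul_le_mul_of_nonneg_left (h j) (abs_nonneg _))
    _ = ε * ((∑ j, |x j|) * ∑ k, |y k|) := by rw [← Finset.sum_mul]; ring

theorem sq_sum_abs_le (x : ι → ℝ) : (∑ j, |x j|) ^ 2 ≤ Fintype.card ι * ∑ j, x j ^ 2 := by
  have := sq_sum_le_card_mul_sum_sq (s := Finset.univ) (f := fun j => |x j|)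
  simpa using this

/-- Entrywise closeness controls the quadratic forms at the price of the dimension, by
Cauchy–Schwarz; concentration of finitely many scalar averages is therefore enough. -/
theorem abs_dotProduct_mulVec_sub_le {M M' : Matrix ι ι ℝ} {ε : ℝ} (hε : 0 ≤ ε)
    (hM : ∀ j k, |M j k - M' j k| ≤ ε) (x : ι → ℝ) :
    |x ⬝ᵥ (M *ᵥ x) - x ⬝ᵥ (M' *ᵥ x)| ≤ ε * (Fintype.card ι * ∑ j, x j ^ 2) := by
  rw [← dotProduct_sub, ← sub_mulVec]
  refine (abs_dotProduct_mulVec_le (M := M - M') hM x x).trans ?_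
  rw [← sq]
  exact mul_le_mul_of_nonneg_left (sq_sum_abs_le x) hε

end MatrixLemmas

/-! ### Information matrices as second moments -/

section Information

open Matrix

variable {X S A : Type*} {d₁ d₂ : ℕ} (F : Features X S A d₁ d₂) {n : ℕ}

/-- The gradient of the logit with respect to the joint parameter. -/
noncomputable def logitGrad (θ : Vec d₁) (γ : Vec d₂) (o : Obs X S A) : Fin d₁ ⊕ Fin d₂ → ℝ :=
  Sum.elim (fun j => scale F γ (ctx o) * featDiff F o j)
    (fun k => inner ℝ θ (featDiff F o) * F.psi (ctx o) k)

/-- The joint empirical information matrix. -/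
noncomputable def empInfo (D : Fin n → Obs X S A) (θ : Vec d₁) (γ : Vec d₂) :
    Matrix (Fin d₁ ⊕ Fin d₂) (Fin d₁ ⊕ Fin d₂) ℝ :=
  Matrix.of fun j k => avg D fun o => logitVar F θ γ o * logitGrad F θ γ o j * logitGrad F θ γ o k

theorem fromBlocks_empInfo (D : Fin n → Obs X S A) (θ : Vec d₁) (γ : Vec d₂) :
    fromBlocks (empInfoTT F D θ γ) (empInfoGT F D θ γ)ᵀ (empInfoGT F D θ γ)ᵀᵀ (empInfoGG F D θ γ)
      = empInfo F D θ γ := by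
  ext j k
  rcases j with j | j <;> rcases k with k | k <;>
  · simp only [fromBlocks_apply₁₁, fromBlocks_apply₁₂, fromBlocks_apply₂₁, fromBlocks_apply₂₂,
      empInfoTT, empInfoGT, empInfoGG, empInfo, avg, of_apply, transpose_apply, Matrix.smul_apply,
      Matrix.sum_apply, outer, vecMulVec_apply, logitGrad, Sum.elim_inl, Sum.elim_inr, smul_eq_mul]
    congr 1
    refine Finset.sum_congr rfl fun i _ => ?_
    ring

theorem sum_logitGrad_mul (θ : Vec d₁) (γ : Vec d₂) (a : Vec d₁) (c : Vec d₂) (o : Obs X S A) :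
    ∑ j, logitGrad F θ γ o j * Sum.elim a.ofLp c.ofLp j = logitDiff F θ γ a c o := by
  simp only [Fintype.sum_sum_type, logitGrad, Sum.elim_inl, Sum.elim_inr, logitDiff,
    PiLp.inner_apply (𝕜 := ℝ) a, PiLp.inner_apply (𝕜 := ℝ) c, Finset.mul_sum]
  simp [mul_assoc]

theorem sum_sq_elim (a : Vec d₁) (c : Vec d₂) :
    ∑ j, Sum.elim a.ofLp c.ofLp j ^ 2 = ‖a‖ ^ 2 + ‖c‖ ^ 2 := by
  simp [Fintype.sum_sum_type, EuclideanSpace.real_norm_sq_eq]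

theorem dotProduct_mulVec_eq_sum {ι : Type*} [Fintype ι] (M : Matrix ι ι ℝ) (x : ι → ℝ) :
    x ⬝ᵥ (M *ᵥ x) = ∑ j, ∑ k, x j * x k * M j k := by
  simp only [dotProduct, mulVec, Finset.mul_sum]
  exact Finset.sum_congr rfl fun j _ => Finset.sum_congr rfl fun k _ => by ring

theorem sum_sum_mul_eq_sq {ι : Type*} [Fintype ι] (w : ℝ) (g x : ι → ℝ) :
    ∑ j, ∑ k, x j * x k * (w * g j * g k) = w * (∑ j, g j * x j) ^ 2 := by
  rw [sq, Finset.sum_mul_sum, Finset.mul_sum]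
  refine Finset.sum_congr rfl fun j _ => ?_
  rw [Finset.mul_sum]
  exact Finset.sum_congr rfl fun k _ => by ring

theorem dotProduct_empInfo (D : Fin n → Obs X S A) (θ : Vec d₁) (γ : Vec d₂) (a : Vec d₁)
    (c : Vec d₂) :
    Sum.elim a.ofLp c.ofLp ⬝ᵥ (empInfo F D θ γ *ᵥ Sum.elim a.ofLp c.ofLp)
      = avg D fun o => logitVar F θ γ o * logitDiff F θ γ a c o ^ 2 := by
  simp only [dotProduct_mulVec_eq_sum, empInfo, of_apply, ← avg_const_mul, ← avg_sum,
    sum_sum_mul_eq_sq, sum_logitGrad_mul]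

theorem isHermitian_empInfo (D : Fin n → Obs X S A) (θ : Vec d₁) (γ : Vec d₂) :
    (empInfo F D θ γ).IsHermitian := by
  ext j k
  simp only [conjTranspose_apply, star_trivial, empInfo, of_apply]
  congr 1
  ext o
  ring

variable {F}

/-- A coercive joint information form makes `Î_{γγ}` and the Schur complement positive definite. -/
theorem posDef_empSchur {D : Fin n → Obs X S A} {θ : Vec d₁} {γ : Vec d₂} {m : ℝ} (hm : 0 < m)
    (h : ∀ a c, m * (‖a‖ ^ 2 + ‖c‖ ^ 2)
      ≤ avg D fun o => logitVar F θ γ o * logitDiff F θ γ a c o ^ 2) :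
    (empInfoGG F D θ γ).PosDef ∧ (empSchur F D θ γ).PosDef ∧
      ∀ u : Vec d₁, u.ofLp ⬝ᵥ (empSchur F D θ γ *ᵥ u.ofLp)
        ≤ avg D fun o => logitVar F θ γ o * logitDiff F θ γ u 0 o ^ 2 := by
  have hpd : (empInfo F D θ γ).PosDef := by
    refine PosDef.of_dotProduct_mulVec_pos (isHermitian_empInfo F D θ γ) fun v hv => ?_
    obtain ⟨a, c, rfl⟩ : ∃ (a : Vec d₁) (c : Vec d₂), v = Sum.elim a.ofLp c.ofLp :=
      ⟨WithLp.toLp 2 (v ∘ Sum.inl), WithLp.toLp 2 (v ∘ Sum.inr),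
        (Sum.elim_comp_inl_inr v).symm⟩
    rw [star_trivial, dotProduct_empInfo]
    refine lt_of_lt_of_le (mul_pos hm ?_) (h a c)
    rw [← sum_sq_elim]
    obtain ⟨j, hj⟩ := Function.ne_iff.1 hv
    exact Finset.sum_pos' (fun _ _ => sq_nonneg _) ⟨j, Finset.mem_univ j, by
      exact sq_pos_of_ne_zero hj⟩
  have hpd' := hpd
  rw [← fromBlocks_empInfo] at hpd'
  have hGG := posDef_right_of_fromBlocks hpd'
  refine ⟨hGG, posDef_schur_of_fromBlocks hpd', fun u => ?_⟩
  refine (dotProduct_schur_le _ _ hGG u.ofLp).trans_eq ?_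
  rw [← dotProduct_empInfo, ← fromBlocks_empInfo, fromBlocks_mulVec]
  simp

end Information

/-! ### Concentration of averages of bounded functions -/

section Concentration

variable {Ω : Type*} [MeasurableSpace Ω] (Q : Measure Ω) [IsProbabilityMeasure Q]

/-- Hoeffding's inequality: values in $[-C,C]$ give sub-Gaussian variance proxy $C^2$, and
independence adds the proxies. -/
theorem measureReal_le_avg_sub_integral {h : Ω → ℝ} (hm : Measurable h) {C : ℝ} (hC0 : 0 ≤ C)
    (hC : ∀ o, |h o| ≤ C) {n : ℕ} (hn : n ≠ 0) {t : ℝ} (ht : 0 ≤ t) :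
    (Measure.pi fun _ : Fin n => Q).real {D | t ≤ avg D h - ∫ o, h o ∂Q}
      ≤ Real.exp (-(n * t ^ 2 / (2 * C ^ 2))) := by
  have hnpos : (0 : ℝ) < n := Nat.cast_pos.2 (Nat.pos_of_ne_zero hn)
  have hsub : HasSubgaussianMGF (fun o => h o - ∫ o, h o ∂Q) ((‖C - -C‖₊ / 2) ^ 2) Q :=
    hasSubgaussianMGF_of_mem_Icc hm.aemeasurable
      (Filter.Eventually.of_forall fun o => abs_le.1 (hC o))
  have hsubi : ∀ i ∈ (Finset.univ : Finset (Fin n)),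
      HasSubgaussianMGF (fun D : Fin n → Ω => h (D i) - ∫ o, h o ∂Q) ((‖C - -C‖₊ / 2) ^ 2)
        (Measure.pi fun _ : Fin n => Q) := fun i _ => by
    refine HasSubgaussianMGF.of_map (Y := fun D : Fin n → Ω => D i)
      (X := fun o : Ω => h o - ∫ o, h o ∂Q) (measurable_pi_apply i).aemeasurable ?_
    have hmap : (Measure.pi fun _ : Fin n => Q).map (fun D => D i) = Q :=
      (measurePreserving_eval (fun _ : Fin n => Q) i).map_eq
    rwa [hmap]
  have hind : iIndepFun (fun i (D : Fin n → Ω) => h (D i) - ∫ o, h o ∂Q)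
      (Measure.pi fun _ : Fin n => Q) :=
    iIndepFun_pi (X := fun _ o => h o - ∫ o, h o ∂Q) fun _ => (hm.sub_const _).aemeasurable
  have key := HasSubgaussianMGF.measure_sum_ge_le_of_iIndepFun hind hsubi
    (mul_nonneg hnpos.le ht)
  have hset : {D : Fin n → Ω | t ≤ avg D h - ∫ o, h o ∂Q}
      = {D | n * t ≤ ∑ i, (h (D i) - ∫ o, h o ∂Q)} := by
    ext D
    simp only [Set.mem_ofPred_eq, avg, Finset.sum_sub_distrib, Finset.sum_const, Finset.card_univ,
      Fintype.card_fin, nsmul_eq_mul]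
    rw [← mul_le_mul_iff_of_pos_left hnpos, mul_sub, ← mul_assoc, mul_one_div_cancel hnpos.ne',
      one_mul]
  rw [hset]
  refine key.trans_eq ?_
  congr 1
  have hc : ‖C - -C‖ / 2 = C := by
    rw [sub_neg_eq_add, Real.norm_of_nonneg (by linarith)]; ring
  simp only [Finset.sum_const, Finset.card_univ, Fintype.card_fin, nsmul_eq_mul, NNReal.coe_mul,
    NNReal.coe_natCast, NNReal.coe_pow, NNReal.coe_div, coe_nnnorm, NNReal.coe_ofNat, hc]
  -- For `C = 0` both exponents are zero by the convention for division by zero.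
  rcases eq_or_ne C 0 with rfl | hC'
  · simp
  · field_simp

theorem measureReal_le_abs_avg_sub_integral {h : Ω → ℝ} (hm : Measurable h) {C : ℝ} (hC0 : 0 ≤ C)
    (hC : ∀ o, |h o| ≤ C) {n : ℕ} (hn : n ≠ 0) {t : ℝ} (ht : 0 ≤ t) :
    (Measure.pi fun _ : Fin n => Q).real {D | t ≤ |avg D h - ∫ o, h o ∂Q|}
      ≤ 2 * Real.exp (-(n * t ^ 2 / (2 * C ^ 2))) := by
  have h1 := measureReal_le_avg_sub_integral Q hm hC0 hC hn ht
  have h2 := measureReal_le_avg_sub_integral Q (h := fun o => -h o) hm.neg hC0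
    (fun o => by rw [abs_neg]; exact hC o) hn ht
  have hsub : {D : Fin n → Ω | t ≤ |avg D h - ∫ o, h o ∂Q|}
      ⊆ {D | t ≤ avg D h - ∫ o, h o ∂Q} ∪
        {D | t ≤ avg D (fun o => -h o) - ∫ o, -h o ∂Q} := by
    intro D hD
    have e : avg D (fun o => -h o) - ∫ o, -h o ∂Q = -(avg D h - ∫ o, h o ∂Q) := by
      rw [integral_neg, show (fun o => -h o) = fun o => (-1) * h o by simp, avg_const_mul]
      ring
    rcases le_abs.1 (Set.mem_ofPred_eq ▸ hD) with h' | h'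
    · exact Or.inl h'
    · exact Or.inr (by rw [Set.mem_ofPred_eq, e]; exact h')
  linarith [measureReal_mono (μ := Measure.pi fun _ : Fin n => Q) hsub,
    measureReal_union_le (μ := Measure.pi fun _ : Fin n => Q)
      {D | t ≤ avg D h - ∫ o, h o ∂Q} {D | t ≤ avg D (fun o => -h o) - ∫ o, -h o ∂Q}]

theorem measureReal_exists_le_abs_avg_sub_integral {κ : Type*} [Fintype κ] {h : κ → Ω → ℝ}
    (hm : ∀ k, Measurable (h k)) {C : ℝ} (hC0 : 0 ≤ C) (hC : ∀ k o, |h k o| ≤ C)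
    {n : ℕ} (hn : n ≠ 0) {t : ℝ} (ht : 0 ≤ t) :
    (Measure.pi fun _ : Fin n => Q).real {D | ∃ k, t ≤ |avg D (h k) - ∫ o, h k o ∂Q|}
      ≤ Fintype.card κ * (2 * Real.exp (-(n * t ^ 2 / (2 * C ^ 2)))) := by
  rw [Set.ofPred_exists]
  refine (measureReal_iUnion_fintype_le _).trans ?_
  refine (Finset.sum_le_sum fun k _ =>
    measureReal_le_abs_avg_sub_integral Q (hm k) hC0 (hC k) hn ht).trans_eq ?_
  simp

end Concentration

/-! ### The population information matrix -/

section Population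

open Matrix

theorem dotProduct_mulVec_integral {Ω ι : Type*} [MeasurableSpace Ω] {Q : Measure Ω} [Fintype ι]
    {f : ι → ι → Ω → ℝ} (hf : ∀ j k, Integrable (f j k) Q) (x : ι → ℝ) :
    x ⬝ᵥ ((Matrix.of fun j k => ∫ o, f j k o ∂Q) *ᵥ x)
      = ∫ o, ∑ j, ∑ k, x j * x k * f j k o ∂Q := by
  rw [dotProduct_mulVec_eq_sum, integral_finsetSum _ fun j _ =>
    integrable_finsetSum _ fun k _ => (hf j k).const_mul _]
  refine Finset.sum_congr rfl fun j _ => ?_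
  rw [integral_finsetSum _ fun k _ => (hf j k).const_mul _]
  exact Finset.sum_congr rfl fun k _ => (integral_const_mul _ _).symm

theorem posDef_of_isLeast_spectrum {ι : Type*} [Fintype ι] [DecidableEq ι] {M : Matrix ι ι ℝ}
    (hM : M.IsHermitian) {l : ℝ} (hl : 0 < l) (h : IsLeast (spectrum ℝ M) l) : M.PosDef :=
  hM.posDef_iff_eigenvalues_pos.2 fun i =>
    hl.trans_le (h.2 (hM.eigenvalues_mem_spectrum_real i))

variable {X S A : Type*} {d₁ d₂ : ℕ} {F : Features X S A d₁ d₂}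
  {θs : Vec d₁} {γs : Vec d₂} {B : ℝ}

theorem exists_featureBound {φmax θmax ψmax γmax : ℝ} (h₁ : RewardBounds F θs φmax θmax)
    (h₂ : ScaleBounds F γs ψmax γmax) : ∃ B, FeatureBound F θs γs B := by
  have hφ := h₁.phi_pos
  have hψ := h₂.psi_pos
  have hz : ∀ o : Obs X S A, ‖featDiff F o‖ ≤ 2 * φmax := fun o =>
    ((norm_sub_le _ _).trans (add_le_add (h₁.phi_le _ _) (h₁.phi_le _ _))).trans_eq
      (two_mul φmax).symm
  have hp0 : ∀ x, |F.psi0 x| ≤ ψmax := fun x =>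
    (Real.abs_le_sqrt (by nlinarith [sq_nonneg ‖F.psi x‖])).trans (h₂.psi_le x)
  have hp : ∀ x, ‖F.psi x‖ ≤ ψmax := fun x =>
    (Real.le_sqrt_of_sq_le (by nlinarith [sq_nonneg (F.psi0 x)])).trans (h₂.psi_le x)
  have n1 : 0 ≤ ‖γs‖ * ψmax := by positivity
  have n2 : 0 ≤ ‖θs‖ * (2 * φmax) := by positivity
  refine ⟨1 + 2 * φmax + ψmax + ‖γs‖ * ψmax + ‖θs‖ * (2 * φmax), by linarith, fun o => ?_,
    fun x => ?_, fun x => ?_, fun o => ?_⟩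
  · linarith [hz o]
  · linarith [hp x]
  · have h3 := (abs_real_inner_le_norm γs (F.psi x)).trans
      (mul_le_mul_of_nonneg_left (hp x) (norm_nonneg _))
    unfold scale
    linarith [abs_add_le (F.psi0 x) (inner ℝ γs (F.psi x)), hp0 x]
  · have h3 := (abs_real_inner_le_norm θs (featDiff F o)).trans
      (mul_le_mul_of_nonneg_left (hz o) (norm_nonneg _))
    linarith

theorem abs_coord_le {d : ℕ} {v : Vec d} (hv : ‖v‖ ≤ B) (j : Fin d) : |v j| ≤ B :=
  (PiLp.norm_apply_le v j).trans hv

theorem FeatureBound.abs_logitGrad_le (H : FeatureBound F θs γs B) (o : Obs X S A)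
    (j : Fin d₁ ⊕ Fin d₂) : |logitGrad F θs γs o j| ≤ B ^ 2 := by
  have hB : 0 ≤ B := by linarith [H.one_le]
  rcases j with j | j <;> simp only [logitGrad, Sum.elim_inl, Sum.elim_inr, abs_mul, sq]
  · exact mul_le_mul (H.scale_le _) (abs_coord_le (H.featDiff_le o) j) (abs_nonneg _) hB
  · exact mul_le_mul (H.inner_le _) (abs_coord_le (H.psi_le _) j) (abs_nonneg _) hB

theorem abs_logitVar_le_one (θ : Vec d₁) (γ : Vec d₂) (o : Obs X S A) :
    |logitVar F θ γ o| ≤ 1 := by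
  rw [logitVar_eq, abs_of_pos (sigmoidVar_pos _)]
  exact sigmoidVar_le_one _

theorem FeatureBound.abs_info_le (H : FeatureBound F θs γs B) (o : Obs X S A)
    (j k : Fin d₁ ⊕ Fin d₂) :
    |logitVar F θs γs o * logitGrad F θs γs o j * logitGrad F θs γs o k| ≤ B ^ 4 := by
  rw [abs_mul, abs_mul]
  have h := mul_le_mul (abs_logitVar_le_one (F := F) θs γs o) (H.abs_logitGrad_le o j)
    (abs_nonneg _) zero_le_one
  exact (mul_le_mul h (H.abs_logitGrad_le o k) (abs_nonneg _) (by positivity)).trans_eq (by ring)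

theorem FeatureBound.abs_residual_mul_logitGrad_le (H : FeatureBound F θs γs B) (o : Obs X S A)
    (j : Fin d₁ ⊕ Fin d₂) : |residual F θs γs o * logitGrad F θs γs o j| ≤ B ^ 4 := by
  rw [abs_mul]
  refine (mul_le_mul (abs_residual_le_one F θs γs o) (H.abs_logitGrad_le o j)
    (abs_nonneg _) zero_le_one).trans ?_
  have : 1 ≤ B ^ 2 := one_le_pow₀ H.one_le
  nlinarith

theorem FeatureBound.abs_cross_coord_le (H : FeatureBound F θs γs B) (o : Obs X S A)
    (j : Fin d₁) (k : Fin d₂) : |featDiff F o j * F.psi (ctx o) k| ≤ B ^ 2 := by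
  have hB : 0 ≤ B := by linarith [H.one_le]
  rw [abs_mul, sq]
  exact mul_le_mul (abs_coord_le (H.featDiff_le o) j) (abs_coord_le (H.psi_le _) k)
    (abs_nonneg _) hB

theorem FeatureBound.abs_residual_mul_cross_le (H : FeatureBound F θs γs B) (o : Obs X S A)
    (j : Fin d₁) (k : Fin d₂) :
    |residual F θs γs o * (featDiff F o j * F.psi (ctx o) k)| ≤ B ^ 4 := by
  rw [abs_mul]
  refine (mul_le_mul (abs_residual_le_one F θs γs o) (H.abs_cross_coord_le o j k)
    (abs_nonneg _) zero_le_one).trans ?_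
  have : 1 ≤ B ^ 2 := one_le_pow₀ H.one_le
  nlinarith

/-- True logits lie in $[-B^2,B^2]$ and $1-\mu(v)=\mu(-v)$, so both factors are at least
$\mu(-B^2)$. -/
theorem FeatureBound.exists_le_logitVar (H : FeatureBound F θs γs B) :
    ∃ w > 0, ∀ o, w ≤ logitVar F θs γs o := by
  have hB : 0 ≤ B := by linarith [H.one_le]
  refine ⟨Real.sigmoid (-B ^ 2) * Real.sigmoid (-B ^ 2),
    mul_pos (Real.sigmoid_pos _) (Real.sigmoid_pos _), fun o => ?_⟩
  have hv : |logit F θs γs o| ≤ B ^ 2 := by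
    rw [logit_eq, abs_mul, sq]
    exact mul_le_mul (H.scale_le _) (H.inner_le o) (abs_nonneg _) hB
  rw [logitVar, ← Real.sigmoid_neg]
  exact mul_le_mul (Real.sigmoid_le (abs_le.1 hv).1) (Real.sigmoid_le (neg_le_neg (abs_le.1 hv).2))
    (Real.sigmoid_pos _).le (Real.sigmoid_pos _).le

variable [MeasurableSpace X] [MeasurableSpace S] [MeasurableSpace A]

theorem measurable_label : Measurable (label : Obs X S A → ℝ) := by
  have : (label : Obs X S A → ℝ) = (fun b : Bool => if b then (1 : ℝ) else 0) ∘ Prod.snd := rfl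
  rw [this]
  exact (measurable_of_countable _).comp measurable_snd

theorem measurable_ctx : Measurable (ctx : Obs X S A → X) := measurable_fst.comp measurable_fst

theorem Features.IsMeasurable.featDiff (hF : F.IsMeasurable) : Measurable (featDiff F) := by
  have h1 : Measurable fun o : Obs X S A => (o.1.2.1, o.1.2.2.2) := by fun_prop
  have h0 : Measurable fun o : Obs X S A => (o.1.2.1, o.1.2.2.1) := by fun_prop
  exact (hF.phi.comp h1).sub (hF.phi.comp h0)

theorem measurable_coord {Ω : Type*} [MeasurableSpace Ω] {d : ℕ} {f : Ω → Vec d}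
    (hf : Measurable f) (j : Fin d) : Measurable fun o => f o j :=
  (EuclideanSpace.proj (𝕜 := ℝ) j).continuous.measurable.comp hf

theorem Features.IsMeasurable.inner_featDiff (hF : F.IsMeasurable) (θ : Vec d₁) :
    Measurable fun o : Obs X S A => (inner ℝ θ (RewardLearning.featDiff F o) : ℝ) :=
  measurable_const.inner hF.featDiff

theorem Features.IsMeasurable.scale_ctx (hF : F.IsMeasurable) (γ : Vec d₂) :
    Measurable fun o : Obs X S A => scale F γ (ctx o) :=
  (hF.psi0.add (measurable_const.inner hF.psi)).comp measurable_ctx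

theorem Features.IsMeasurable.logit (hF : F.IsMeasurable) (θ : Vec d₁) (γ : Vec d₂) :
    Measurable (logit F θ γ) := by
  rw [funext fun o => logit_eq F θ γ o]
  exact (hF.scale_ctx γ).mul (hF.inner_featDiff θ)

theorem Features.IsMeasurable.sigmoid_logit (hF : F.IsMeasurable) (θ : Vec d₁) (γ : Vec d₂) :
    Measurable fun o => Real.sigmoid (RewardLearning.logit F θ γ o) :=
  continuous_sigmoid.measurable.comp (hF.logit θ γ)

theorem Features.IsMeasurable.logitVar (hF : F.IsMeasurable) (θ : Vec d₁) (γ : Vec d₂) :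
    Measurable (logitVar F θ γ) :=
  (hF.sigmoid_logit θ γ).mul ((hF.sigmoid_logit θ γ).const_sub 1)

theorem Features.IsMeasurable.residual (hF : F.IsMeasurable) (θ : Vec d₁) (γ : Vec d₂) :
    Measurable (residual F θ γ) :=
  (hF.sigmoid_logit θ γ).sub measurable_label

theorem Features.IsMeasurable.logitGrad (hF : F.IsMeasurable) (θ : Vec d₁) (γ : Vec d₂)
    (j : Fin d₁ ⊕ Fin d₂) : Measurable fun o => logitGrad F θ γ o j := by
  rcases j with j | j
  · exact (hF.scale_ctx γ).mul (measurable_coord hF.featDiff j)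
  · exact (hF.inner_featDiff θ).mul (measurable_coord (hF.psi.comp measurable_ctx) j)

theorem Features.IsMeasurable.cross_coord (hF : F.IsMeasurable) (j : Fin d₁) (k : Fin d₂) :
    Measurable fun o : Obs X S A => RewardLearning.featDiff F o j * F.psi (ctx o) k :=
  (measurable_coord hF.featDiff j).mul (measurable_coord (hF.psi.comp measurable_ctx) k)

variable {Q : Measure (Obs X S A)}

variable (F Q) in
/-- The joint population information matrix. -/
noncomputable def popInfo (θ : Vec d₁) (γ : Vec d₂) :
    Matrix (Fin d₁ ⊕ Fin d₂) (Fin d₁ ⊕ Fin d₂) ℝ :=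
  Matrix.of fun j k => ∫ o, logitVar F θ γ o * logitGrad F θ γ o j * logitGrad F θ γ o k ∂Q

theorem popInfo_symm (j k : Fin d₁ ⊕ Fin d₂) : popInfo F Q θs γs j k = popInfo F Q θs γs k j := by
  simp only [popInfo, of_apply]
  congr 1
  ext o
  ring

theorem infoGT_eq_transpose (θ : Vec d₁) (γ : Vec d₂) :
    infoGT F Q θ γ = (infoTG F Q θ γ)ᵀ := by
  ext j k
  simp only [infoGT, infoTG, expMat, of_apply, transpose_apply, hessGT_obsLoss, hessTG_obsLoss]

variable [IsProbabilityMeasure Q]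

/-- Residuals are orthogonal to bounded functions of the covariates. -/
theorem FollowsModel.integral_residual_mul (hmodel : FollowsModel F Q θs γs) (hF : F.IsMeasurable)
    {g : Obs X S A → ℝ} (hg : Measurable fun p => g (p, true)) (hg' : ∀ o, g o = g (o.1, true))
    {C : ℝ} (hC : ∀ o, |g o| ≤ C) : ∫ o, residual F θs γs o * g o ∂Q = 0 := by
  have hgm : Measurable g := by
    rw [funext hg']
    exact hg.comp measurable_fst
  -- By `hg'` the function ignores the label, so it is measurable for the covariate σ-algebra and
  -- can be pulled out of the conditional expectation.
  have hgsm : StronglyMeasurable[MeasurableSpace.comap Prod.fst inferInstance] g := by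
    rw [funext hg']
    exact (hg.comp (comap_measurable _)).stronglyMeasurable
  have hle : MeasurableSpace.comap (Prod.fst : Obs X S A → _) inferInstance
      ≤ (inferInstance : MeasurableSpace (Obs X S A)) := measurable_fst.comap_le
  have hlabel : Integrable (label : Obs X S A → ℝ) Q :=
    Integrable.of_bound measurable_label.aestronglyMeasurable 1
      (Filter.Eventually.of_forall fun o => by
        rw [Real.norm_of_nonneg (label_nonneg o)]; exact label_le_one o)
  have hgl : Integrable (fun o => g o * label o) Q :=
    hlabel.bdd_mul hgm.aestronglyMeasurable (Filter.Eventually.of_forall hC)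
  have hgs : Integrable (fun o => g o * Real.sigmoid (logit F θs γs o)) Q := by
    refine Integrable.bdd_mul (c := C) ?_ hgm.aestronglyMeasurable (Filter.Eventually.of_forall hC)
    refine Integrable.of_bound (hF.sigmoid_logit θs γs).aestronglyMeasurable 1
      (Filter.Eventually.of_forall fun o => ?_)
    rw [Real.norm_of_nonneg (Real.sigmoid_nonneg _)]
    exact Real.sigmoid_le_one _
  have h1 := condExp_stronglyMeasurable_mul_of_bound hle hgsm hlabel C
    (Filter.Eventually.of_forall hC)
  have h2 : ∫ o, g o * label o ∂Q = ∫ o, g o * Real.sigmoid (logit F θs γs o) ∂Q := by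
    have h3 := integral_condExp hle (μ := Q) (f := g * (label : Obs X S A → ℝ))
    rw [show (∫ o, g o * label o ∂Q) = ∫ o, (g * (label : Obs X S A → ℝ)) o ∂Q from rfl, ← h3]
    refine integral_congr_ae ?_
    filter_upwards [h1, hmodel] with o ho ho'
    rw [ho, Pi.mul_apply, ho']
  have h4 : (fun o => residual F θs γs o * g o)
      = fun o => g o * Real.sigmoid (logit F θs γs o) - g o * label o := by
    ext o
    unfold residual
    ring
  rw [h4, integral_sub hgs hgl, h2, sub_self]

theorem FollowsModel.integral_residual_mul_cross (hmodel : FollowsModel F Q θs γs)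
    (hF : F.IsMeasurable) (H : FeatureBound F θs γs B) (j : Fin d₁) (k : Fin d₂) :
    ∫ o, residual F θs γs o * (featDiff F o j * F.psi (ctx o) k) ∂Q = 0 :=
  hmodel.integral_residual_mul hF ((hF.cross_coord j k).comp measurable_prodMk_right)
    (fun _ => rfl) fun o => H.abs_cross_coord_le o j k

theorem FollowsModel.integral_residual_mul_logitGrad (hmodel : FollowsModel F Q θs γs)
    (hF : F.IsMeasurable) (H : FeatureBound F θs γs B) (j : Fin d₁ ⊕ Fin d₂) :
    ∫ o, residual F θs γs o * logitGrad F θs γs o j ∂Q = 0 :=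
  hmodel.integral_residual_mul hF ((hF.logitGrad θs γs j).comp measurable_prodMk_right)
    (fun _ => rfl) fun o => H.abs_logitGrad_le o j

theorem FeatureBound.integrable_info (H : FeatureBound F θs γs B) (hF : F.IsMeasurable)
    (j k : Fin d₁ ⊕ Fin d₂) :
    Integrable (fun o => logitVar F θs γs o * logitGrad F θs γs o j * logitGrad F θs γs o k) Q :=
  Integrable.of_bound (((hF.logitVar θs γs).mul (hF.logitGrad θs γs j)).mul
    (hF.logitGrad θs γs k)).aestronglyMeasurable (B ^ 4)
    (Filter.Eventually.of_forall fun o => H.abs_info_le o j k)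

theorem FollowsModel.integral_info_add_residual (hmodel : FollowsModel F Q θs γs)
    (hF : F.IsMeasurable) (H : FeatureBound F θs γs B) (j : Fin d₁) (k : Fin d₂) :
    ∫ o, (logitVar F θs γs o * (scale F γs (ctx o) * featDiff F o j)
        * (inner ℝ θs (featDiff F o) * F.psi (ctx o) k)
      + residual F θs γs o * (featDiff F o j * F.psi (ctx o) k)) ∂Q
      = popInfo F Q θs γs (Sum.inl j) (Sum.inr k) := by
  have h := H.integrable_info (Q := Q) hF (Sum.inl j) (Sum.inr k)
  have h' : Integrable (fun o => residual F θs γs o * (featDiff F o j * F.psi (ctx o) k)) Q :=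
    Integrable.of_bound ((hF.residual θs γs).mul (hF.cross_coord j k)).aestronglyMeasurable (B ^ 4)
      (Filter.Eventually.of_forall fun o => H.abs_residual_mul_cross_le o j k)
  refine (integral_add h h').trans ?_
  rw [hmodel.integral_residual_mul_cross hF H, add_zero]
  rfl

/-- In expectation the residual part of the mixed block disappears, which leaves the weighted second
moment of the logit gradient. -/
theorem FollowsModel.fromBlocks_info (hmodel : FollowsModel F Q θs γs)
    (hF : F.IsMeasurable) (H : FeatureBound F θs γs B) :
    fromBlocks (infoTT F Q θs γs) (infoTG F Q θs γs) (infoTG F Q θs γs)ᵀ (infoGG F Q θs γs)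
      = popInfo F Q θs γs := by
  ext j k
  rcases j with j | j <;> rcases k with k | k
  · simp only [fromBlocks_apply₁₁, infoTT, expMat, of_apply, hessTT_obsLoss]
    rfl
  · simp only [fromBlocks_apply₁₂, infoTG, expMat, of_apply, hessTG_obsLoss]
    exact hmodel.integral_info_add_residual hF H j k
  · simp only [fromBlocks_apply₂₁, transpose_apply, infoTG, expMat, of_apply, hessTG_obsLoss]
    rw [popInfo_symm]
    exact hmodel.integral_info_add_residual hF H k j
  · simp only [fromBlocks_apply₂₂, infoGG, expMat, of_apply, hessGG_obsLoss]
    rfl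

/-- Up to the weight $\mu(1-\mu)$, which is bounded below by a positive constant, this is the matrix
whose smallest eigenvalue is `lpsi`. -/
theorem WellConditioned.posDef_infoGG {lphi lpsi : ℝ} (hcond : WellConditioned F Q θs γs lphi lpsi)
    (hF : F.IsMeasurable) (H : FeatureBound F θs γs B) : (infoGG F Q θs γs).PosDef := by
  have hB : 0 ≤ B := by linarith [H.one_le]
  obtain ⟨w, hw, hwle⟩ := H.exists_le_logitVar
  set g : Obs X S A → Fin d₂ → ℝ := fun o k => logitGrad F θs γs o (Sum.inr k) with hg
  have hG : infoGG F Q θs γs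
      = Matrix.of fun j k => ∫ o, logitVar F θs γs o * g o j * g o k ∂Q := by
    ext j k
    simp only [infoGG, expMat, of_apply, hessGG_obsLoss]
    rfl
  have hE : (expMat Q fun o => inner ℝ θs (featDiff F o) ^ 2 •
      outer (F.psi (ctx o)) (F.psi (ctx o))) = Matrix.of fun j k => ∫ o, 1 * g o j * g o k ∂Q := by
    ext j k
    simp only [expMat, of_apply, Matrix.smul_apply, outer, vecMulVec_apply, smul_eq_mul]
    congr 1
    ext o
    simp only [hg, logitGrad, Sum.elim_inr]
    ring
  have hgint : ∀ j k, Integrable (fun o => 1 * g o j * g o k) Q := fun j k => by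
    refine Integrable.of_bound ((measurable_const.mul (hF.logitGrad θs γs (Sum.inr j))).mul
      (hF.logitGrad θs γs (Sum.inr k))).aestronglyMeasurable (B ^ 2 * B ^ 2)
      (Filter.Eventually.of_forall fun o => ?_)
    rw [one_mul, norm_mul]
    exact mul_le_mul (H.abs_logitGrad_le o _) (H.abs_logitGrad_le o _) (norm_nonneg _)
      (by positivity)
  have hgint' : ∀ j k, Integrable (fun o => logitVar F θs γs o * g o j * g o k) Q :=
    fun j k => H.integrable_info hF (Sum.inr j) (Sum.inr k)
  have hEpd := posDef_of_isLeast_spectrum (by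
    rw [hE]
    ext j k
    simp only [conjTranspose_apply, of_apply, star_trivial]
    congr 1
    ext o
    ring) hcond.lpsi_pos hcond.lpsi_least
  refine PosDef.of_dotProduct_mulVec_pos ?_ fun x hx => ?_
  · rw [hG]
    ext j k
    simp only [conjTranspose_apply, of_apply, star_trivial]
    congr 1
    ext o
    ring
  · have h1 := hEpd.dotProduct_mulVec_pos hx
    rw [star_trivial, hE, dotProduct_mulVec_integral hgint] at h1
    rw [star_trivial, hG, dotProduct_mulVec_integral hgint']
    refine lt_of_lt_of_le (mul_pos hw h1) ?_
    rw [← integral_const_mul]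
    refine integral_mono ?_ ?_ fun o => ?_
    · exact (integrable_finsetSum _ fun j _ => integrable_finsetSum _ fun k _ =>
        (hgint j k).const_mul _).const_mul _
    · exact integrable_finsetSum _ fun j _ => integrable_finsetSum _ fun k _ =>
        (hgint' j k).const_mul _
    · simp only [sum_sum_mul_eq_sq]
      rw [one_mul]
      exact mul_le_mul_of_nonneg_right (hwle o) (sq_nonneg _)

theorem FollowsModel.posDef_popInfo (hmodel : FollowsModel F Q θs γs) {lphi lpsi : ℝ}
    (hcond : WellConditioned F Q θs γs lphi lpsi) (heff : (effInfo F Q θs γs).PosDef)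
    (hF : F.IsMeasurable) (H : FeatureBound F θs γs B) : (popInfo F Q θs γs).PosDef := by
  rw [← hmodel.fromBlocks_info hF H]
  refine posDef_fromBlocks_of_schur (hcond.posDef_infoGG hF H) ?_
  rwa [effInfo, infoGT_eq_transpose] at heff

end Population

/-! ### Normal quantiles and sample sizes -/

theorem cdf_gaussianReal_lt_one (x : ℝ) : cdf (gaussianReal 0 1) x < 1 := by
  refine lt_of_le_of_ne (cdf_le_one _ x) fun h => ?_
  rw [cdf_eq_real] at h
  have h1 : (gaussianReal 0 1).real (Set.Iic x)ᶜ = 0 := by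
    rw [probReal_compl_eq_one_sub measurableSet_Iic, h, sub_self]
  rw [Set.compl_Iic, measureReal_eq_zero_iff] at h1
  -- Lebesgue measure is absolutely continuous with respect to the Gaussian, so a Gaussian-null ray
  -- would be Lebesgue-null.
  have h2 := gaussianReal_absolutelyContinuous' 0 one_ne_zero h1
  simp at h2

theorem exists_le_normalQuantile (K : ℝ) :
    ∃ α : ℝ, 0 < α ∧ α < 1 ∧ K ≤ normalQuantile (1 - α / 2) := by
  have h1 := cdf_gaussianReal_lt_one K
  have h0 := cdf_nonneg (gaussianReal 0 1) K
  -- Half the tail mass beyond `K`: then $1-\alpha/2$ exceeds the distribution function at `K`, so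
  -- every competitor in the infimum lies above `K`. Nonemptiness must be checked, since the infimum
  -- of the empty set is 0.
  refine ⟨(1 - cdf (gaussianReal 0 1) K) / 2, by linarith, by linarith, ?_⟩
  refine le_csInf ?_ fun x hx => ?_
  · have ht := tendsto_cdf_atTop (gaussianReal 0 1)
    exact (ht.eventually_const_le (u := 1 - (1 - cdf (gaussianReal 0 1) K) / 2 / 2)
      (by linarith)).exists
  · by_contra hlt
    have h2 := monotone_cdf (gaussianReal 0 1) (not_le.1 hlt).le
    have h3 : 1 - (1 - cdf (gaussianReal 0 1) K) / 2 / 2 ≤ cdf (gaussianReal 0 1) x := hx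
    linarith

theorem exists_forall_mul_exp_le_inv (N : ℝ) {a : ℝ} (ha : 0 < a) :
    ∃ n₀ : ℕ, ∀ n : ℕ, n₀ < n → N * Real.exp (-(n * a)) ≤ 1 / n := by
  have h := ((Real.tendsto_pow_mul_exp_neg_atTop_nhds_zero 1).comp
    (tendsto_natCast_atTop_atTop.atTop_mul_const ha)).const_mul (N / a)
  rw [mul_zero] at h
  obtain ⟨n₀, hn₀⟩ := Filter.eventually_atTop.1 (h.eventually_le_const (u := 1) one_pos)
  refine ⟨n₀, fun n hn => ?_⟩
  have hn0 : (0 : ℝ) < n := Nat.cast_pos.2 (by omega)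
  rw [le_div_iff₀ hn0]
  have := hn₀ n hn.le
  simp only [Function.comp_apply, pow_one] at this
  refine le_trans (le_of_eq ?_) this
  field_simp

theorem exists_mul_exp_le (N : ℝ) {a δ : ℝ} (ha : 0 < a) (hδ : 0 < δ) :
    ∃ K : ℝ, 0 < K ∧ N * Real.exp (-(K ^ 2 * a)) ≤ δ := by
  have h : Filter.Tendsto (fun K : ℝ => N * Real.exp (-(K ^ 2 * a))) Filter.atTop (nhds 0) := by
    have := (Real.tendsto_exp_neg_atTop_nhds_zero.comp
      ((Filter.tendsto_pow_atTop (α := ℝ) two_ne_zero).atTop_mul_const ha)).const_mul N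
    rwa [mul_zero] at this
  obtain ⟨K, h1, h2⟩ := ((h.eventually_le_const hδ).and (Filter.eventually_gt_atTop 0)).exists
  exact ⟨K, h2, h1⟩

theorem pow_le_inv_of_log {ρ : ℝ} (h0 : 0 < ρ) (h1 : ρ < 1) {n T : ℕ} (hn : 0 < n)
    (hT : 1 / (-Real.log ρ) * Real.log n < T) : ρ ^ T ≤ 1 / n := by
  have hn0 : (0 : ℝ) < n := Nat.cast_pos.2 hn
  have hlog : 0 < -Real.log ρ := neg_pos.2 (Real.log_neg h0 h1)
  rw [one_div_mul_eq_div, div_lt_iff₀ hlog] at hT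
  rw [← Real.log_le_log_iff (pow_pos h0 T) (by positivity), Real.log_pow, one_div, Real.log_inv]
  linarith

/-- Subadditivity replaces the complement formula, so the event need not be measurable. -/
theorem one_sub_le_measureReal {Ω : Type*} [MeasurableSpace Ω] {μ : Measure Ω}
    [IsProbabilityMeasure μ] {s : Set Ω} {ε : ℝ} (h : μ.real sᶜ ≤ ε) : 1 - ε ≤ μ.real s := by
  have := measureReal_union_le (μ := μ) s sᶜ
  rw [Set.union_compl_self, probReal_univ] at this
  linarith

/-! ### Accuracy of alternating gradient descent on a good sample -/

section GoodSample

open Matrix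

variable {X S A : Type*} {d₁ d₂ : ℕ} {F : Features X S A d₁ d₂}
  {θs : Vec d₁} {γs : Vec d₂} {B : ℝ} {n : ℕ}

/-- The score at the truth is bounded at two levels: the fixed `ε` traps the iterates through
`hsmall`, while `κ`, later of order $n^{-1/2}$, gives the accuracy. The factor $64=4\cdot16$
combines $\hat{\mathcal I}_{\theta\theta}\le4B^4$ with the inverse of the coefficient $m/16$ in
`sq_dist_le`. -/
theorem FeatureBound.weightedNorm_agd_le (H : FeatureBound F θs γs B) {D : Fin n → Obs X S A}
    (hn : n ≠ 0) {R m : ℝ} (hm : 0 < m) (hR0 : 0 ≤ R) (hR : R ≤ 1)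
    (hRm : 104 * B ^ 6 * R ≤ m)
    (hinfo : ∀ a c, m * (‖a‖ ^ 2 + ‖c‖ ^ 2)
      ≤ avg D fun o => logitVar F θs γs o * logitDiff F θs γs a c o ^ 2)
    (hcross : ∀ a c, |avg D fun o => residual F θs γs o * logitCross F a c o|
      ≤ m / 4 * (‖a‖ ^ 2 + ‖c‖ ^ 2))
    {ε κ : ℝ} (hTε : ‖empScoreT F D θs γs‖ ≤ ε) (hGε : ‖empScoreG F D θs γs‖ ≤ ε)
    (hTκ : ‖empScoreT F D θs γs‖ ≤ κ) (hGκ : ‖empScoreG F D θs γs‖ ≤ κ)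
    {η₁ η₂ : ℝ} (h₁ : 0 < η₁) (h₂ : 0 < η₂)
    (h₁L : η₁ * (5 * B ^ 4) ≤ 1) (h₂L : η₂ * (5 * B ^ 4) ≤ 1)
    (h₁M : η₁ * (2 * B ^ 2) ≤ R / 2) (h₂M : η₂ * (2 * B ^ 2) ≤ R / 2)
    (hm₁ : η₁ * (m / 4) ≤ 1) {b : ℝ} (hbR : b ≤ R / 2)
    (hsmall : 2 * (2 * B ^ 2) * b + 2 * ε ^ 2 / (m / 4) ≤ m / 4 / 4 * (R / 2) ^ 2)
    {θ₀ : Vec d₁} {γ₀ : Vec d₂} (hθ₀ : ‖θ₀ - θs‖ ≤ b) (hγ₀ : ‖γ₀ - γs‖ ≤ b)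
    {T : ℕ} {r : ℝ} (hr : (1 - min η₁ η₂ * (m / 4) / 3) ^ T ≤ r) :
    (empInfoGG F D (agd F D η₁ η₂ θ₀ γ₀ T).1 (agd F D η₁ η₂ θ₀ γ₀ T).2).PosDef ∧
    (empSchur F D (agd F D η₁ η₂ θ₀ γ₀ T).1 (agd F D η₁ η₂ θ₀ γ₀ T).2).PosDef ∧
    weightedNorm (Ssq F D (agd F D η₁ η₂ θ₀ γ₀ T).1 (agd F D η₁ η₂ θ₀ γ₀ T).2)⁻¹
        ((agd F D η₁ η₂ θ₀ γ₀ T).1 - θs)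
      ≤ √(64 * B ^ 4 / m * (r * (4 * B ^ 2 * b) + 8 * κ ^ 2 / m)) := by
  have hB : 0 ≤ B := by linarith [H.one_le]
  have hb : 0 ≤ b := (norm_nonneg _).trans hθ₀
  have hreg := H.locallyRegular_empLoss D hn hR (by linarith) hinfo hcross
  obtain ⟨i1, i2, i3⟩ := hreg.iterate (by positivity) hR0 (by positivity) h₁ h₂ h₁L h₂L h₁M h₂M
    hm₁ hTε hGε hbR hsmall (u := agd F D η₁ η₂ θ₀ γ₀)
    (fun t => by rw [← gradient_empLoss_left]; rfl)
    (fun t => by rw [← gradient_empLoss_right]; rfl) hθ₀ hγ₀ T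
  set θ := (agd F D η₁ η₂ θ₀ γ₀ T).1
  set γ := (agd F D η₁ η₂ θ₀ γ₀ T).2
  have hθR : ‖θ - θs‖ ≤ R := by linarith
  have hγR : ‖γ - γs‖ ≤ R := by linarith
  have hdist := hreg.sq_dist_le (by positivity) hTκ hGκ hθR hγR
  -- Moving the information from the truth to the iterate costs $30B^6R\le m/2$, by `hRm`.
  have hcoer : ∀ a c, m / 2 * (‖a‖ ^ 2 + ‖c‖ ^ 2)
      ≤ avg D fun o => logitVar F θ γ o * logitDiff F θ γ a c o ^ 2 := fun a c => by
    have h := avg_mono D fun o => H.le_logitDiff_sq hR hθR hγR a c o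
    simp only [avg_sub, avg_const D hn] at h
    have h3 := mul_le_mul_of_nonneg_right hRm (by positivity : 0 ≤ ‖a‖ ^ 2 + ‖c‖ ^ 2)
    have h4 : 0 ≤ B ^ 6 * R * (‖a‖ ^ 2 + ‖c‖ ^ 2) := by positivity
    linarith [hinfo a c]
  obtain ⟨p1, p2, p3⟩ := posDef_empSchur (by positivity) hcoer
  refine ⟨p1, p2, ?_⟩
  rw [Ssq, nonsing_inv_nonsing_inv _ ((isUnit_iff_isUnit_det _).1 p2.isUnit), weightedNorm]
  refine Real.sqrt_le_sqrt ((p3 (θ - θs)).trans ?_)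
  have hup : (avg D fun o => logitVar F θ γ o * logitDiff F θ γ (θ - θs) 0 o ^ 2)
      ≤ 4 * B ^ 4 * ‖θ - θs‖ ^ 2 := by
    refine (avg_mono D fun o => ?_).trans_eq (avg_const D hn (4 * B ^ 4 * ‖θ - θs‖ ^ 2))
    have h := sq_mul_inner_le (u := θ - θs) hB (H.abs_scale_le hR hγR (ctx o)) (H.featDiff_le o)
    unfold logitDiff
    rw [inner_zero_left, mul_zero, add_zero]
    exact (mul_le_of_le_one_left (sq_nonneg _) (sigmoidVar_le_one _)).trans h
  refine hup.trans ?_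
  have h5 : ‖θ - θs‖ ^ 2 ≤ 16 / m * (r * (4 * B ^ 2 * b) + 8 * κ ^ 2 / m) := by
    have h6 := mul_le_mul_of_nonneg_right hr (by positivity : 0 ≤ 2 * (2 * B ^ 2) * b)
    have h7 : m / 4 / 4 * ‖θ - θs‖ ^ 2 ≤ r * (4 * B ^ 2 * b) + 8 * κ ^ 2 / m := by
      have h8 : 2 * κ ^ 2 / (m / 4) = 8 * κ ^ 2 / m := by field_simp; ring
      have h9 : 0 ≤ m / 4 / 4 * ‖γ - γs‖ ^ 2 := by positivity
      linarith
    calc ‖θ - θs‖ ^ 2 = 16 / m * (m / 4 / 4 * ‖θ - θs‖ ^ 2) := by field_simp; ring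
      _ ≤ _ := by gcongr
  calc 4 * B ^ 4 * ‖θ - θs‖ ^ 2
      ≤ 4 * B ^ 4 * (16 / m * (r * (4 * B ^ 2 * b) + 8 * κ ^ 2 / m)) := by gcongr
    _ = _ := by ring

/-- The index type of the statistics whose averages have to concentrate. -/
abbrev StatIndex (d₁ d₂ : ℕ) :=
  ((Fin d₁ ⊕ Fin d₂) × (Fin d₁ ⊕ Fin d₂)) ⊕ ((Fin d₁ × Fin d₂) ⊕ (Fin d₁ ⊕ Fin d₂))

variable (F) in
/-- Information entries, residual cross terms and score coordinates of one observation. -/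
noncomputable def stat (θ : Vec d₁) (γ : Vec d₂) : StatIndex d₁ d₂ → Obs X S A → ℝ
  | Sum.inl (j, k) => fun o => logitVar F θ γ o * logitGrad F θ γ o j * logitGrad F θ γ o k
  | Sum.inr (Sum.inl (j, k)) => fun o => residual F θ γ o * (featDiff F o j * F.psi (ctx o) k)
  | Sum.inr (Sum.inr j) => fun o => residual F θ γ o * logitGrad F θ γ o j

theorem FeatureBound.abs_stat_le (H : FeatureBound F θs γs B) (i : StatIndex d₁ d₂)
    (o : Obs X S A) : |stat F θs γs i o| ≤ B ^ 4 := by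
  rcases i with ⟨j, k⟩ | ⟨j, k⟩ | j
  · exact H.abs_info_le o j k
  · exact H.abs_residual_mul_cross_le o j k
  · exact H.abs_residual_mul_logitGrad_le o j

theorem norm_le_of_forall_abs_le {d N : ℕ} (hd : d ≤ N) {v : Vec d} {ε : ℝ} (hε : 0 ≤ ε)
    (h : ∀ j, |v j| ≤ ε) : ‖v‖ ≤ N * ε := by
  have h1 : ‖v‖ ^ 2 ≤ d * ε ^ 2 := by
    rw [EuclideanSpace.real_norm_sq_eq]
    refine (Finset.sum_le_sum fun j _ => sq_le_sq' (abs_le.1 (h j)).1 (abs_le.1 (h j)).2).trans_eq ?_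
    simp
  have h2 : (d : ℝ) ≤ N := Nat.cast_le.2 hd
  have h3 : (d : ℝ) ≤ d ^ 2 := by
    exact_mod_cast Nat.le_self_pow two_ne_zero d
  refine (sq_le_sq₀ (norm_nonneg _) (by positivity)).1 (h1.trans ?_)
  rw [mul_pow]
  refine mul_le_mul_of_nonneg_right (h3.trans ?_) (sq_nonneg ε)
  exact pow_le_pow_left₀ (Nat.cast_nonneg d) h2 2

theorem empScoreT_apply (D : Fin n → Obs X S A) (θ : Vec d₁) (γ : Vec d₂) (j : Fin d₁) :
    empScoreT F D θ γ j = avg D fun o => residual F θ γ o * logitGrad F θ γ o (Sum.inl j) := by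
  simp [empScoreT, avg, scoreT, logitGrad, mul_assoc]

theorem empScoreG_apply (D : Fin n → Obs X S A) (θ : Vec d₁) (γ : Vec d₂) (k : Fin d₂) :
    empScoreG F D θ γ k = avg D fun o => residual F θ γ o * logitGrad F θ γ o (Sum.inr k) := by
  simp [empScoreG, avg, scoreG, logitGrad, mul_assoc]

theorem norm_empScore_le {D : Fin n → Obs X S A} {θ : Vec d₁} {γ : Vec d₂} {ε : ℝ} (hε : 0 ≤ ε)
    (h : ∀ j, |avg D fun o => residual F θ γ o * logitGrad F θ γ o j| ≤ ε) :
    ‖empScoreT F D θ γ‖ ≤ (d₁ + d₂ : ℕ) * ε ∧ ‖empScoreG F D θ γ‖ ≤ (d₁ + d₂ : ℕ) * ε :=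
  ⟨norm_le_of_forall_abs_le (Nat.le_add_right _ _) hε fun j => by
      rw [empScoreT_apply]; exact h _,
    norm_le_of_forall_abs_le (Nat.le_add_left _ _) hε fun j => by
      rw [empScoreG_apply]; exact h _⟩

theorem abs_avg_residual_mul_cross_le {D : Fin n → Obs X S A} {θ : Vec d₁} {γ : Vec d₂} {ε : ℝ}
    (hε : 0 ≤ ε)
    (h : ∀ j k, |avg D fun o => residual F θ γ o * (featDiff F o j * F.psi (ctx o) k)| ≤ ε)
    (a : Vec d₁) (c : Vec d₂) :
    |avg D fun o => residual F θ γ o * logitCross F a c o|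
      ≤ (d₁ + d₂ : ℕ) * ε / 2 * (‖a‖ ^ 2 + ‖c‖ ^ 2) := by
  have e : (avg D fun o => residual F θ γ o * logitCross F a c o)
      = a.ofLp ⬝ᵥ ((Matrix.of fun j k =>
        avg D fun o => residual F θ γ o * (featDiff F o j * F.psi (ctx o) k)) *ᵥ c.ofLp) := by
    simp only [dotProduct, mulVec, of_apply, Finset.mul_sum]
    simp only [mul_comm _ (c.ofLp _), ← avg_const_mul, ← avg_sum]
    congr 1
    ext o
    simp only [logitCross, PiLp.inner_apply (𝕜 := ℝ) a, PiLp.inner_apply (𝕜 := ℝ) c]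
    rw [mul_comm (∑ i, _), Finset.sum_mul_sum, Finset.mul_sum]
    refine Finset.sum_congr rfl fun j _ => ?_
    rw [Finset.mul_sum]
    refine Finset.sum_congr rfl fun k _ => ?_
    simp
    ring
  rw [e]
  refine (abs_dotProduct_mulVec_le (M := Matrix.of fun j k => avg D fun o =>
    residual F θ γ o * (featDiff F o j * F.psi (ctx o) k)) h _ _).trans ?_
  have ha := sq_sum_abs_le a.ofLp
  have hc := sq_sum_abs_le c.ofLp
  rw [← EuclideanSpace.real_norm_sq_eq, Fintype.card_fin] at ha hc
  have h1 : (∑ j, |a.ofLp j|) * ∑ k, |c.ofLp k|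
      ≤ (d₁ + d₂ : ℕ) / 2 * (‖a‖ ^ 2 + ‖c‖ ^ 2) := by
    push_cast
    have h2 : 0 ≤ (d₁ : ℝ) * ‖c‖ ^ 2 := by positivity
    have h3 : 0 ≤ (d₂ : ℝ) * ‖a‖ ^ 2 := by positivity
    nlinarith [sq_nonneg ((∑ j, |a.ofLp j|) - ∑ k, |c.ofLp k|)]
  exact (mul_le_mul_of_nonneg_left h1 hε).trans_eq (by ring)

variable [MeasurableSpace X] [MeasurableSpace S] [MeasurableSpace A]

theorem Features.IsMeasurable.stat (hF : F.IsMeasurable) (θ : Vec d₁) (γ : Vec d₂)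
    (i : StatIndex d₁ d₂) : Measurable (stat F θ γ i) := by
  rcases i with ⟨j, k⟩ | ⟨j, k⟩ | j
  · exact ((hF.logitVar θ γ).mul (hF.logitGrad θ γ j)).mul (hF.logitGrad θ γ k)
  · exact (hF.residual θ γ).mul (hF.cross_coord j k)
  · exact (hF.residual θ γ).mul (hF.logitGrad θ γ j)

theorem le_avg_info {Q : Measure (Obs X S A)} {D : Fin n → Obs X S A} {m ε : ℝ} (hε : 0 ≤ ε)
    (hpop : ∀ x, m * ∑ i, x i ^ 2 ≤ x ⬝ᵥ (popInfo F Q θs γs *ᵥ x))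
    (h : ∀ j k, |empInfo F D θs γs j k - popInfo F Q θs γs j k| ≤ ε) (a : Vec d₁) (c : Vec d₂) :
    (m - (d₁ + d₂ : ℕ) * ε) * (‖a‖ ^ 2 + ‖c‖ ^ 2)
      ≤ avg D fun o => logitVar F θs γs o * logitDiff F θs γs a c o ^ 2 := by
  have h1 := hpop (Sum.elim a.ofLp c.ofLp)
  have h2 := (abs_le.1 (abs_dotProduct_mulVec_sub_le hε h (Sum.elim a.ofLp c.ofLp))).1
  rw [dotProduct_empInfo, sum_sq_elim, Fintype.card_sum, Fintype.card_fin, Fintype.card_fin] at h2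
  rw [sum_sq_elim] at h1
  linarith

end GoodSample

end RewardLearning

/-! ### The main theorem: choice of constants and good events -/

open RewardLearning

theorem mainTheorem7 {X S A : Type*}
    [MeasurableSpace X] [MeasurableSpace S] [MeasurableSpace A] {d₁ d₂ : ℕ}
    (F : RewardLearning.Features X S A d₁ d₂) (hF : F.IsMeasurable)
    (θs : RewardLearning.Vec d₁) (γs : RewardLearning.Vec d₂)
    (Q : Measure (RewardLearning.Obs X S A)) [IsProbabilityMeasure Q]
    (hmodel : RewardLearning.FollowsModel F Q θs γs)
    (φmax θmax ψmax γmax lphi lpsi : ℝ)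
    (hreward : RewardLearning.RewardBounds F θs φmax θmax)
    (hscale : RewardLearning.ScaleBounds F γs ψmax γmax)
    (hcond : RewardLearning.WellConditioned F Q θs γs lphi lpsi)
    (hcross : RewardLearning.crossNorm F Q θs γs <
      min lphi lpsi / (6 * RewardLearning.cZero d₁ d₂ φmax θmax ψmax γmax lphi lpsi))
    (heff : (RewardLearning.effInfo F Q θs γs).PosDef) :
    ∃ b₀ : ℝ, 0 < b₀ ∧ ∀ b : ℝ, 0 ≤ b → b < b₀ →
    ∃ η₀ : ℝ, 0 < η₀ ∧ ∀ η₁ η₂ : ℝ, 0 < η₁ → η₁ < η₀ → 0 < η₂ → η₂ < η₀ →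
    ∃ n₀ : ℕ, ∀ δ : ℝ, 0 < δ → δ < 1 →
    ∃ α : ℝ, 0 < α ∧ α < 1 ∧ ∃ c : ℝ, 0 < c ∧
    ∀ (θ₀ : RewardLearning.Vec d₁) (γ₀ : RewardLearning.Vec d₂),
      ‖θ₀ - θs‖ ≤ b / Real.sqrt 2 → ‖γ₀ - γs‖ ≤ b / Real.sqrt 2 →
    ∀ n T : ℕ, n₀ < n → c * Real.log n < T →
      1 - δ - 1 / (n : ℝ) ≤
        (Measure.pi fun _ : Fin n => Q).real
          {D : Fin n → RewardLearning.Obs X S A |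
            let θT := (RewardLearning.agd F D η₁ η₂ θ₀ γ₀ T).1
            let γT := (RewardLearning.agd F D η₁ η₂ θ₀ γ₀ T).2
            (RewardLearning.empInfoGG F D θT γT).PosDef ∧
            (RewardLearning.empSchur F D θT γT).PosDef ∧
            RewardLearning.weightedNorm (RewardLearning.Ssq F D θT γT)⁻¹ (θT - θs) ≤
              RewardLearning.normalQuantile (1 - α / 2) / Real.sqrt n} := by
  obtain ⟨B, H⟩ := exists_featureBound hreward hscale
  have hB1 := H.one_le
  have hB : 0 < B := by linarith
  obtain ⟨m₀, hm₀, hpop⟩ := exists_coercive_of_posDef (hmodel.posDef_popInfo hcond heff hF H)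
  -- Halving the population coercivity leaves room for the sampling error.
  obtain ⟨m, hm, hmm⟩ : ∃ m, 0 < m ∧ 2 * m = m₀ := ⟨m₀ / 2, by linarith, by ring⟩
  obtain ⟨R, hR0, hR1, hRm⟩ : ∃ R, 0 < R ∧ R ≤ 1 ∧ 104 * B ^ 6 * R ≤ m := by
    refine ⟨min 1 (m / (104 * B ^ 6)), by positivity, min_le_left _ _, ?_⟩
    rw [← le_div_iff₀' (by positivity)]
    exact min_le_right _ _
  -- `m / 2` serves the information and the residual cross term; `m * R / 32` serves `hsmall`, where
  -- the score and the initial gap each get $mR^2/128$ of the available $mR^2/64$.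
  obtain ⟨e, he0, hem, heR⟩ : ∃ e, 0 < e ∧ e ≤ m / 2 ∧ e ≤ m * R / 32 :=
    ⟨min (m / 2) (m * R / 32), by positivity, min_le_left _ _, min_le_right _ _⟩
  obtain ⟨ε, hε0, hεe⟩ : ∃ ε, 0 < ε ∧ (d₁ + d₂ : ℕ) * ε ≤ e := by
    refine ⟨e / ((d₁ + d₂ : ℕ) + 1), by positivity, ?_⟩
    rw [mul_div_assoc', div_le_iff₀ (by positivity)]
    nlinarith
  refine ⟨min (R / 2) (m * R ^ 2 / (512 * B ^ 2)), by positivity, fun b hb0 hb => ?_⟩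
  have hbR : b ≤ R / 2 := hb.le.trans (min_le_left _ _)
  have hbm : 512 * B ^ 2 * b ≤ m * R ^ 2 := by
    rw [← le_div_iff₀' (by positivity)]
    exact hb.le.trans (min_le_right _ _)
  refine ⟨min (1 / (5 * B ^ 4)) (min (R / 2 / (2 * B ^ 2)) (1 / (m / 4))), by positivity,
    fun η₁ η₂ h₁ h₁' h₂ h₂' => ?_⟩
  have hη : ∀ η, η < min (1 / (5 * B ^ 4)) (min (R / 2 / (2 * B ^ 2)) (1 / (m / 4))) →
      η * (5 * B ^ 4) ≤ 1 ∧ η * (2 * B ^ 2) ≤ R / 2 ∧ η * (m / 4) ≤ 1 := fun η h => by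
    obtain ⟨a1, a2, a3⟩ : η ≤ _ ∧ η ≤ _ ∧ η ≤ _ := by simpa only [le_min_iff] using h.le
    exact ⟨(le_div_iff₀ (by positivity)).1 a1, (le_div_iff₀ (by positivity)).1 a2,
      (le_div_iff₀ (by positivity)).1 a3⟩
  obtain ⟨h₁L, h₁M, h₁m⟩ := hη η₁ h₁'
  obtain ⟨h₂L, h₂M, -⟩ := hη η₂ h₂'
  -- This event uses the fixed precision `ε`, so `n₀` is independent of `δ`.
  obtain ⟨n₀, hn₀⟩ := exists_forall_mul_exp_le_inv (Fintype.card (StatIndex d₁ d₂) * 2)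
    (a := ε ^ 2 / (2 * (B ^ 4) ^ 2)) (by positivity)
  refine ⟨n₀, fun δ hδ0 hδ1 => ?_⟩
  -- At threshold $K/\sqrt n$ the Hoeffding exponent is free of `n`; a `K` depending on `δ` thus
  -- works for every positive sample size.
  obtain ⟨K, hK0, hK⟩ := exists_mul_exp_le (Fintype.card (Fin d₁ ⊕ Fin d₂) * 2)
    (a := 1 / (2 * (B ^ 4) ^ 2)) (by positivity) hδ0
  obtain ⟨α, hα0, hα1, hα⟩ := exists_le_normalQuantile
    √(64 * B ^ 4 / m * (4 * B ^ 2 * b + 8 * ((d₁ + d₂ : ℕ) * K) ^ 2 / m))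
  set ρ := 1 - min η₁ η₂ * (m / 4) / 3 with hρ
  have hηm : 0 < min η₁ η₂ * (m / 4) := mul_pos (lt_min h₁ h₂) (by positivity)
  have hηm' : min η₁ η₂ * (m / 4) ≤ 1 :=
    (mul_le_mul_of_nonneg_right (min_le_left _ _) (by positivity)).trans h₁m
  have hρ0 : 0 < ρ := by linarith
  have hρ1 : ρ < 1 := by linarith
  refine ⟨α, hα0, hα1, 1 / (-Real.log ρ),
    one_div_pos.2 (neg_pos.2 (Real.log_neg hρ0 hρ1)), fun θ₀ γ₀ hθ₀ hγ₀ n T hn hT => ?_⟩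
  have hn0 : n ≠ 0 := by omega
  have hnpos : (0 : ℝ) < n := Nat.cast_pos.2 (Nat.pos_of_ne_zero hn0)
  have hbs : b / √2 ≤ b := div_le_self hb0 (Real.one_le_sqrt.2 one_le_two)
  have hρT := pow_le_inv_of_log hρ0 hρ1 (Nat.pos_of_ne_zero hn0) hT
  have hP₁ := (measureReal_exists_le_abs_avg_sub_integral Q (fun i => hF.stat θs γs i)
    (by positivity) H.abs_stat_le hn0 hε0.le).trans_eq
      (show _ = Fintype.card (StatIndex d₁ d₂) * 2 * Real.exp (-(n * (ε ^ 2 / (2 * (B ^ 4) ^ 2))))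
        by rw [mul_div_assoc, mul_assoc])
  have hP₂ := (measureReal_exists_le_abs_avg_sub_integral Q
    (h := fun j o => RewardLearning.residual F θs γs o * logitGrad F θs γs o j)
    (fun j => (hF.residual θs γs).mul (hF.logitGrad θs γs j)) (by positivity)
    (fun j o => H.abs_residual_mul_logitGrad_le o j) hn0
    (by positivity : 0 ≤ K / √n)).trans_eq
      (show _ = Fintype.card (Fin d₁ ⊕ Fin d₂) * 2 * Real.exp (-(K ^ 2 * (1 / (2 * (B ^ 4) ^ 2))))
        by rw [div_pow, Real.sq_sqrt hnpos.le, mul_div_cancel₀ _ hnpos.ne', mul_assoc,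
          mul_one_div])
  rw [sub_sub]
  refine one_sub_le_measureReal ?_
  refine le_trans (measureReal_mono (fun D hD => ?_)) ((measureReal_union_le _ _).trans
    (add_le_add (hP₂.trans hK) (hP₁.trans (hn₀ n hn))))
  by_contra hgood
  rw [Set.mem_union, not_or] at hgood
  obtain ⟨hg₂, hg₁⟩ := hgood
  simp only [Set.mem_ofPred_eq, not_exists, not_le] at hg₁ hg₂
  refine hD ?_
  have g1 : ∀ j k, |empInfo F D θs γs j k - popInfo F Q θs γs j k| ≤ ε :=
    fun j k => (hg₁ (Sum.inl (j, k))).le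
  have g2 : ∀ j k, |avg D fun o => residual F θs γs o * (featDiff F o j * F.psi (ctx o) k)| ≤ ε :=
    fun j k => by
      have := (hg₁ (Sum.inr (Sum.inl (j, k)))).le
      simp only [stat] at this
      rwa [hmodel.integral_residual_mul_cross hF H, sub_zero] at this
  have g3 : ∀ j, |avg D fun o => residual F θs γs o * logitGrad F θs γs o j| ≤ ε := fun j => by
    have := (hg₁ (Sum.inr (Sum.inr j))).le
    simp only [stat] at this
    rwa [hmodel.integral_residual_mul_logitGrad hF H, sub_zero] at this
  have g4 : ∀ j, |avg D fun o => residual F θs γs o * logitGrad F θs γs o j| ≤ K / √n :=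
    fun j => by
      have := (hg₂ j).le
      rwa [hmodel.integral_residual_mul_logitGrad hF H, sub_zero] at this
  have hinfo : ∀ a c, m * (‖a‖ ^ 2 + ‖c‖ ^ 2)
      ≤ avg D fun o => logitVar F θs γs o * logitDiff F θs γs a c o ^ 2 := fun a c =>
    (mul_le_mul_of_nonneg_right (by linarith) (by positivity)).trans
      (le_avg_info hε0.le hpop g1 a c)
  have hcrossE : ∀ a c, |avg D fun o => residual F θs γs o * logitCross F a c o|
      ≤ m / 4 * (‖a‖ ^ 2 + ‖c‖ ^ 2) := fun a c =>
    (abs_avg_residual_mul_cross_le hε0.le g2 a c).trans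
      (mul_le_mul_of_nonneg_right (by linarith) (by positivity))
  obtain ⟨s1, s2⟩ := norm_empScore_le hε0.le g3
  obtain ⟨s3, s4⟩ := norm_empScore_le (by positivity) g4
  have hsmall : 2 * (2 * B ^ 2) * b + 2 * e ^ 2 / (m / 4) ≤ m / 4 / 4 * (R / 2) ^ 2 := by
    have h5 : 2 * e ^ 2 / (m / 4) ≤ m * R ^ 2 / 128 := by
      rw [div_le_iff₀ (by positivity)]
      have := pow_le_pow_left₀ he0.le heR 2
      linarith
    linarith
  obtain ⟨p1, p2, p3⟩ := H.weightedNorm_agd_le hn0 hm hR0.le hR1 hRm hinfo hcrossE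
    (s1.trans hεe) (s2.trans hεe) s3 s4 h₁ h₂ h₁L h₂L h₁M h₂M h₁m hbR hsmall
    (hθ₀.trans hbs) (hγ₀.trans hbs) hρT
  refine ⟨p1, p2, p3.trans ?_⟩
  -- With $r=1/n$ and $\kappa$ proportional to $K/\sqrt n$, both error terms carry the factor $1/n$;
  -- under the root it becomes $1/\sqrt n$ times the constant absorbed by `α`.
  refine le_trans (le_of_eq ?_) (div_le_div_of_nonneg_right hα (Real.sqrt_nonneg n))
  rw [← Real.sqrt_div' _ hnpos.le]
  congr 1
  rw [mul_div_assoc', div_pow, Real.sq_sqrt hnpos.le]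
  field_simp
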